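/- **Setting.** Let $V$ be a finite set, $\pi$ a strictly positive probability vector on $V$, and $\kappa:V\times V\to[0,\infty)$ jump rates satisfying detailed balance $\pi_x\kappa_{xy}=\pi_y\kappa_{yx}$, such that the graph with edge set $E=\{xy:\kappa_{xy}>0\}$ is connected. Fix two distinct nodes $a,b\in V$ (the terminals). For $\varepsilon>0$ put $\kappa^\varepsilon_{xy}=\kappa_{xy}$ if $x\in\{a,b\}$ and $\kappa^\varepsilon_{xy}=\varepsilon^{-1}\kappa_{xy}$ otherwise; let $Z^\varepsilon=\pi_a+\pi_b+\varepsilon\sum_{x\ne a,b}\pi_x$, and $\pi^\varepsilon_x=\pi_x/Z^\varepsilon$ for $x\in\{a,b\}$, $\pi^\varepsilon_x=\varepsilon\pi_x/Z^\varepsilon$ otherwise ($\varepsilon\ge0$). Let $$\mathsf C(s)=2s\log\tfrac{s+\sqrt{s^2+4}}2-2\sqrt{s^2+4}+4,\qquad \mathsf C^*(\xi)=4(\cosh\tfrac\xi2-1),$$ and let $\mathsf C(s|\sigma)=\sigma\,\mathsf C(s/\sigma)$ for $\sigma>0$, $\mathsf C(0|0)=0$, $\mathsf C(s|0)=+\infty$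 for $s\ne0$. Put $\mathcal H(\rho|\pi)=\sum_x\pi_x(u_x\log u_x-u_x+1)$ with $u_x=\rho_x/\pi_x$. On a finite directed graph let $(\overline\nabla f)_{xy}=f_y-f_x$, and let $\mathrm{CE}(0,T)$ be the set of pairs $(\rho,j)$ of a continuous curve $\rho:[0,T]\to[0,\infty)^V$ and an integrable flux $j:[0,T]\to\mathbb R^E$ with $\partial_t\rho+\overline{\mathrm{div}}\,j=0$ weakly, i.e. $\int_0^T\big(\sum_x\partial_t\varphi_x\,\rho_x+\sum_{xy}(\overline\nabla\varphi)_{xy}\,j_{xy}\big)dt=0$ for all $\varphi\in C^1_c((0,T);\mathbb R^V)$. Convergence $(\rho_n,j_n)\to(\rho,j)$ in $\mathrm{CE}(0,T)$ means weak convergence of all $\rho_{n,x}\,dt$ and $j_{n,xy}\,dt$ as measures on $[0,T]$, tested against $C([0,T])$. A gradient system consists of a graph, an energy $\mathcal E$ on $[0,\infty)^V$ and a dissipation potential $\mathcal R(\rho,j)\in[0,\infty]$, convex and lower semicontinuous in $j$ with $\mathcal R(\rho,0)=0$; with $\mathcal R^*$ the convex dual of $\mathcal R$ in $j$, its dissipation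 functional is $$\mathcal D^T(\rho,j)=\int_0^T\big[\mathcal R(\rho,j)+\mathcal R^*(\rho,-\overline\nabla D\mathcal E(\rho))\big]dt\ \text{ if }(\rho,j)\in\mathrm{CE}(0,T),\qquad +\infty\text{ otherwise},$$ where $\rho\mapsto\mathcal R^*(\rho,-\overline\nabla D\mathcal E(\rho))$ is extended continuously from strictly positive $\rho$ to all $\rho\ge0$. **The systems.** For each potential $F:V\to\mathbb R$, the tilted $\varepsilon$-system on $(V,E)$ has $$\mathcal E_{\varepsilon,F}(\rho)=\mathcal H(\rho|\pi^\varepsilon)+\sum_x\rho_xF_x,\qquad \mathcal R_\varepsilon(\rho,j)=\sum_{xy\in E}\mathsf C\big(j_{xy}\,\big|\,\tfrac12\sqrt{\kappa^\varepsilon_{xy}\kappa^\varepsilon_{yx}\rho_x\rho_y}\big),$$ so that $\mathcal R_\varepsilon$ does not depend on $F$. The limit system has nodes $\{a,b\}$, the single edge $ab$, and $$\tilde{\mathcal E}_F(\tilde\rho)=\mathcal H(\tilde\rho\,|\,\pi^0|_{\{a,b\}})+\sum_{x\in\{a,b\}}\tilde\rho_xF_x,\qquad \tilde{\mathcal R}(\tilde\rho,\tilde\jmath;F)=\mathsf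 C\big(\tilde\jmath_{ab}\,\big|\,\mathrm{cap}^F_{ab}\sqrt{u^F_au^F_b}\big),\qquad u^F_x=\frac{\tilde\rho_x}{\pi^0_x}e^{F_x},$$ $$\mathrm{cap}^F_{ab}=\inf\Big\{\tfrac12\sum_{xy\in E}k^F_{xy}|h_y-h_x|^2:\ h:V\to\mathbb R,\ h_a=1,\ h_b=0\Big\},\qquad k^F_{xy}=\frac{\pi_x\kappa_{xy}}{\pi_a+\pi_b}\,e^{-(F_x+F_y)/2}.$$ The limit dissipation potential thus may depend on the tilt $F$, through the effective capacity $\mathrm{cap}^F_{ab}$ (also on its values at non-terminal nodes) and through $u^F$. **Theorem.** For every $F:V\to\mathbb R$ the tilted $\varepsilon$-systems EDP-converge, as $\varepsilon\downarrow0$, to the tilted limit system contracted to $\{a,b\}$. That is: 1. On $[0,\infty)^V$, $\mathcal E_{\varepsilon,F}$ $\Gamma$-converges to a functional $\mathcal E_{0,F}$. 2. $\mathcal E_{0,F}(\rho)=\tilde{\mathcal E}_F(\rho|_{\{a,b\}})$ if $\rho$ vanishes outside $\{a,b\}$, and $\mathcal E_{0,F}(\rho)=+\infty$ otherwise. 3.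 For every $T>0$ there are functionals $\mathcal D_0^\tau$, $\tau\in(0,T]$, on $\mathrm{CE}(0,T)$ such that $\liminf_n\mathcal D^\tau_{\varepsilon_n,F}(\rho_n,j_n)\ge\mathcal D_0^\tau(\rho,j)$ for all $\tau\in(0,T]$, whenever $\varepsilon_n\downarrow0$, $(\rho_n,j_n)\to(\rho,j)$ in $\mathrm{CE}(0,T)$ (with $(\rho_n,j_n),(\rho,j)\in\mathrm{CE}(0,T)$) and $\sup_{n,\,t\in[0,T]}\mathcal E_{\varepsilon_n,F}(\rho_n(t))<\infty$. 4. If $(\rho,j)\in\mathrm{CE}(0,T)$ and $\mathcal E_{0,F}(\rho(t))<\infty$ for all $t\in[0,T]$, then there is $\tilde\jmath$ such that, with $\tilde\rho=\rho|_{\{a,b\}}$, the pair $(\tilde\rho,\tilde\jmath)$ belongs to the $\mathrm{CE}(0,T)$ of the limit graph, and $\mathcal D_0^\tau(\rho,j)=\tilde{\mathcal D}_F^\tau(\tilde\rho,\tilde\jmath)$ for all $\tau\in(0,T]$, where $\tilde{\mathcal D}_F^\tau$ is the dissipation functional of the limit system. -/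

import Mathlib

open Filter Topology MeasureTheory
open scoped NNReal ENNReal

/-! ### The cosh-type Legendre pair and its perspective function -/

/-- `C(s) = 2 s log ((s + √(s² + 4)) / 2) - 2 √(s² + 4) + 4`. -/
noncomputable def coshC (s : ℝ) : ℝ :=
  2 * s * Real.log ((s + Real.sqrt (s ^ 2 + 4)) / 2) - 2 * Real.sqrt (s ^ 2 + 4) + 4

/-- `C*(ξ) = 4 (cosh (ξ / 2) - 1)`. -/
noncomputable def coshCStar (ξ : ℝ) : ℝ := 4 * (Real.cosh (ξ / 2) - 1)

/-- The perspective function `C(s | σ)`, for `σ ≥ 0`: it is `σ C(s / σ)` if `σ > 0`, and for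
`σ = 0` it is `0` at `s = 0` and `+∞` otherwise. -/
noncomputable def coshPersp (s σ : ℝ) : ℝ≥0∞ :=
  if 0 < σ then ENNReal.ofReal (σ * coshC (s / σ)) else if s = 0 then 0 else ⊤

lemma coshC_two_sinh (y : ℝ) :
    coshC (2 * Real.sinh y) = 4 * y * Real.sinh y - 4 * Real.cosh y + 4 := by
  have h1 : Real.sqrt ((2 * Real.sinh y) ^ 2 + 4) = 2 * Real.cosh y := by
    rw [show (2 * Real.sinh y) ^ 2 + 4 = (2 * Real.cosh y) ^ 2 by
      have := Real.cosh_sq y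
      nlinarith]
    exact Real.sqrt_sq (by have := Real.cosh_pos y; linarith)
  have h2 : (2 * Real.sinh y + 2 * Real.cosh y) / 2 = Real.exp y := by
    rw [← Real.cosh_add_sinh]; ring
  unfold coshC
  rw [h1, h2, Real.log_exp]
  ring

lemma exists_two_sinh (s : ℝ) : ∃ y, s = 2 * Real.sinh y :=
  ⟨Real.arsinh (s / 2), by rw [Real.sinh_arsinh]; ring⟩

lemma cosh_tangent (y z : ℝ) :
    Real.cosh y + (z - y) * Real.sinh y ≤ Real.cosh z := by
  have h1 := Real.add_one_le_exp (z - y)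
  have h2 := Real.add_one_le_exp (-(z - y))
  have e1 : Real.exp z = Real.exp y * Real.exp (z - y) := by rw [← Real.exp_add]; ring_nf
  have e2 : Real.exp (-z) = Real.exp (-y) * Real.exp (-(z - y)) := by
    rw [← Real.exp_add]; ring_nf
  have p1 := mul_le_mul_of_nonneg_left h1 (Real.exp_pos y).le
  have p2 := mul_le_mul_of_nonneg_left h2 (Real.exp_pos (-y)).le
  rw [Real.cosh_eq, Real.cosh_eq, Real.sinh_eq, e1, e2]
  nlinarith

lemma coshC_fenchel (s ξ : ℝ) : ξ * s - coshCStar ξ ≤ coshC s := by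
  obtain ⟨y, rfl⟩ := exists_two_sinh s
  rw [coshC_two_sinh]
  have := cosh_tangent y (ξ / 2)
  unfold coshCStar
  nlinarith

lemma coshC_fenchel_eq (ξ : ℝ) :
    coshC (2 * Real.sinh (ξ / 2)) = ξ * (2 * Real.sinh (ξ / 2)) - coshCStar ξ := by
  rw [coshC_two_sinh]; unfold coshCStar; ring

lemma coshC_zero : coshC 0 = 0 := by
  have := coshC_two_sinh 0
  simpa using this

lemma coshCStar_nonneg (ξ : ℝ) : 0 ≤ coshCStar ξ := by
  unfold coshCStar
  have := Real.one_le_cosh (ξ / 2)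
  linarith

lemma coshPersp_ge {σ : ℝ} (hσ : 0 ≤ σ) (s ξ : ℝ) :
    ENNReal.ofReal (ξ * s - σ * coshCStar ξ) ≤ coshPersp s σ := by
  unfold coshPersp
  split_ifs with h h'
  · apply ENNReal.ofReal_le_ofReal
    have := mul_le_mul_of_nonneg_left (coshC_fenchel (s / σ) ξ) h.le
    have e : σ * (ξ * (s / σ) - coshCStar ξ) = ξ * s - σ * coshCStar ξ := by
      field_simp
    linarith
  · subst h'
    have : σ = 0 := le_antisymm (not_lt.mp h) hσ
    simp [this]
  · exact le_top

lemma coshPersp_dual {σ : ℝ} (hσ : 0 ≤ σ) (s : ℝ) :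
    coshPersp s σ = ⨆ ξ : ℝ, ENNReal.ofReal (ξ * s - σ * coshCStar ξ) := by
  apply le_antisymm _ (iSup_le fun ξ => coshPersp_ge hσ s ξ)
  rcases hσ.eq_or_lt with h0 | hpos
  · subst h0
    unfold coshPersp
    by_cases hs : s = 0
    · simp [hs]
    · simp only [lt_irrefl, if_false, hs]
      rw [top_le_iff, iSup_eq_top]
      intro b hb
      refine ⟨(b.toReal + 1) / s, ?_⟩
      rw [div_mul_cancel₀ _ hs, zero_mul, sub_zero, ENNReal.lt_ofReal_iff_toReal_lt hb.ne]
      linarith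
  · obtain ⟨y, hy⟩ := exists_two_sinh (s / σ)
    refine le_trans (le_of_eq ?_) (le_iSup _ (2 * y))
    unfold coshPersp
    rw [if_pos hpos]
    congr 1
    have h1 := coshC_fenchel_eq (2 * y)
    rw [show 2 * y / 2 = y by ring, ← hy] at h1
    rw [h1]
    field_simp

lemma coshPersp_zero (σ : ℝ) : coshPersp 0 σ = 0 := by
  unfold coshPersp
  simp [coshC_zero]

lemma coshPersp_lsc {σ : ℝ} (hσ : 0 ≤ σ) : LowerSemicontinuous fun s => coshPersp s σ := by
  simp_rw [coshPersp_dual hσ]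
  refine lowerSemicontinuous_iSup fun ξ => Continuous.lowerSemicontinuous ?_
  exact ENNReal.continuous_ofReal.comp (by fun_prop)

lemma coshPersp_convex {σ : ℝ} (hσ : 0 ≤ σ) (s t : ℝ) (c d : ℝ≥0) (h : c + d = 1) :
    coshPersp (c * s + d * t) σ ≤ c * coshPersp s σ + d * coshPersp t σ := by
  rw [coshPersp_dual hσ (c * s + d * t)]
  refine iSup_le fun ξ => ?_
  have h' : (c : ℝ) + d = 1 := by exact_mod_cast h
  have e : ξ * (c * s + d * t) - σ * coshCStar ξ
      = c * (ξ * s - σ * coshCStar ξ) + d * (ξ * t - σ * coshCStar ξ) := by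
    linear_combination (σ * coshCStar ξ) * h'
  rw [e]
  refine ENNReal.ofReal_add_le.trans ?_
  rw [ENNReal.ofReal_mul (NNReal.coe_nonneg c), ENNReal.ofReal_mul (NNReal.coe_nonneg d)]
  simp only [ENNReal.ofReal_coe_nnreal]
  gcongr
  · exact coshPersp_ge hσ s ξ
  · exact coshPersp_ge hσ t ξ

/-! ### Directed graphs and the continuity equation

Finite measures on a finite set are identified with vectors: a nonnegative measure on the node
set `V` is a vector `ρ : V → ℝ` with `0 ≤ ρ`, and a flux is a vector `j : E → ℝ`. -/

/-- A directed graph with node set `V` and edge set `E`. -/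
structure EdgeGraph (V E : Type*) where
  src : E → V
  tgt : E → V

/-- The graph gradient `(∇f)_{xy} = f_y - f_x`. -/
def EdgeGraph.grad {V E : Type*} (G : EdgeGraph V E) (f : V → ℝ) (e : E) : ℝ :=
  f (G.tgt e) - f (G.src e)

/-- The pair `(ρ, j)` belongs to `CE(0,T)`: it satisfies `∂ₜρ + div j = 0` on `[0,T]`, tested
against functions in `C¹_c((0,T) × V)`. -/
structure EdgeGraph.CE {V E : Type*} [Fintype V] [Fintype E] (G : EdgeGraph V E) (T : ℝ)
    (ρ : ℝ → V → ℝ) (j : ℝ → E → ℝ) : Prop where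
  nonneg : ∀ t ∈ Set.Icc 0 T, 0 ≤ ρ t
  continuousOn : ContinuousOn ρ (Set.Icc 0 T)
  integrableOn : ∀ e, IntegrableOn (fun t => j t e) (Set.Icc 0 T)
  weak : ∀ φ : V → ℝ → ℝ,
    (∀ x, ContDiff ℝ 1 (φ x) ∧ HasCompactSupport (φ x) ∧ tsupport (φ x) ⊆ Set.Ioo 0 T) →
    (∫ t in Set.Icc 0 T, ∑ x, deriv (φ x) t * ρ t x)
      + (∫ t in Set.Icc 0 T, ∑ e, G.grad (fun x => φ x t) e * j t e) = 0

/-- Convergence in `CE(0,T)`: weak convergence of `ρ_n` and `j_n`, as measures on `[0,T] × V` and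
`[0,T] × E`, tested against continuous functions. -/
structure ConvergesInCE {V E : Type*} (T : ℝ)
    (ρn : ℕ → ℝ → V → ℝ) (jn : ℕ → ℝ → E → ℝ) (ρ : ℝ → V → ℝ) (j : ℝ → E → ℝ) : Prop where
  rho : ∀ x, ∀ φ : ℝ → ℝ, Continuous φ →
    Tendsto (fun n => ∫ t in Set.Icc 0 T, φ t * ρn n t x) atTop
      (𝓝 (∫ t in Set.Icc 0 T, φ t * ρ t x))
  flux : ∀ e, ∀ φ : ℝ → ℝ, Continuous φ →
    Tendsto (fun n => ∫ t in Set.Icc 0 T, φ t * jn n t e) atTop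
      (𝓝 (∫ t in Set.Icc 0 T, φ t * j t e))

/-! ### Gradient systems in continuity-equation format -/

/-- The dual dissipation potential `R*(ρ, Ξ) = sup_j (⟨j, Ξ⟩ - R(ρ, j))`. -/
noncomputable def dualPotential {V E : Type*} [Fintype E] (R : (V → ℝ) → (E → ℝ) → ℝ≥0∞)
    (ρ : V → ℝ) (Ξ : E → ℝ) : EReal :=
  ⨆ j : E → ℝ, ((∑ e, j e * Ξ e : ℝ) : EReal) - (R ρ j : EReal)

/-- A gradient system on the graph `G`: a driving energy and a dissipation potential.

The function `dualTerm` is the rigorous version of `ρ ↦ R*(ρ, -∇DE(ρ))`. It is determined by the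
energy and `R`: it equals that expression where all `ρ_x > 0` (and `DE(ρ)` exists), and it is
the continuous extension from there to all `ρ ≥ 0`. -/
structure GradSystem {V E : Type*} [Fintype V] [Fintype E] (G : EdgeGraph V E) where
  energy : (V → ℝ) → ℝ
  R : (V → ℝ) → (E → ℝ) → ℝ≥0∞
  convex_R : ∀ ρ, 0 ≤ ρ → ConvexOn ℝ≥0 Set.univ (R ρ)
  lsc_R : ∀ ρ, 0 ≤ ρ → LowerSemicontinuous (R ρ)
  R_zero : ∀ ρ, 0 ≤ ρ → R ρ 0 = 0
  dualTerm : (V → ℝ) → ℝ≥0∞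
  dualTerm_eq : ∀ ρ : V → ℝ, (∀ x, 0 < ρ x) → ∃ DE : V → ℝ,
    HasFDerivAt energy (∑ x, DE x • ContinuousLinearMap.proj (R := ℝ) (φ := fun _ : V => ℝ) x) ρ ∧
    (dualTerm ρ : EReal) = dualPotential R ρ (fun e => -G.grad DE e)
  dualTerm_cont : ContinuousOn dualTerm {ρ | 0 ≤ ρ}

open Classical in
/-- The dissipation functional `D^T(ρ, j) = ∫₀ᵀ [R(ρ, j) + R*(ρ, -∇DE(ρ))] dt` if
`(ρ, j) ∈ CE(0,T)`, and `+∞` otherwise. -/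
noncomputable def GradSystem.dissipation {V E : Type*} [Fintype V] [Fintype E]
    {G : EdgeGraph V E} (S : GradSystem G) (T : ℝ) (ρ : ℝ → V → ℝ) (j : ℝ → E → ℝ) : ℝ≥0∞ :=
  if G.CE T ρ j then ∫⁻ t in Set.Icc 0 T, (S.R (ρ t) (j t) + S.dualTerm (ρ t)) else ⊤

/-! ### EDP-convergence with contracted limit -/

/-- Γ-convergence, as `ε ↓ 0`, of functionals on the nonnegative measures on `V`. -/
def GammaConverges {V : Type*} (E : Set.Ioi (0 : ℝ) → (V → ℝ) → ℝ) (E₀ : (V → ℝ) → EReal) :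
    Prop :=
  ∀ ε : ℕ → Set.Ioi (0 : ℝ), Tendsto (fun n => (ε n : ℝ)) atTop (𝓝 0) →
    ∀ ρ : V → ℝ, 0 ≤ ρ →
      (∀ ρn : ℕ → V → ℝ, (∀ n, 0 ≤ ρn n) → Tendsto ρn atTop (𝓝 ρ) →
        E₀ ρ ≤ liminf (fun n => (E (ε n) (ρn n) : EReal)) atTop) ∧
      (∃ ρn : ℕ → V → ℝ, (∀ n, 0 ≤ ρn n) ∧ Tendsto ρn atTop (𝓝 ρ) ∧
        limsup (fun n => (E (ε n) (ρn n) : EReal)) atTop ≤ E₀ ρ)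

/-- The restriction of a measure on `V` to the subset `W`. -/
def restrictTo {V : Type*} (W : Finset V) (ρ : V → ℝ) : W → ℝ := fun x => ρ x

open Classical in
/-- EDP-convergence of the gradient systems `S ε` on `G`, as `ε ↓ 0`, to the gradient system `S'`
on a graph `G'` whose node set is a subset `W` of the node set of `G`. -/
def EDPConverges {V E E' : Type*} [Fintype V] [Fintype E] [Fintype E']
    {G : EdgeGraph V E} {W : Finset V} {G' : EdgeGraph W E'}
    (S : Set.Ioi (0 : ℝ) → GradSystem G) (S' : GradSystem G') : Prop :=
  ∃ E₀ : (V → ℝ) → EReal,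
    GammaConverges (fun ε => (S ε).energy) E₀ ∧
    (∀ ρ : V → ℝ, 0 ≤ ρ →
      E₀ ρ = if ∀ x, x ∉ W → ρ x = 0 then (S'.energy (restrictTo W ρ) : EReal) else ⊤) ∧
    ∀ T : ℝ, 0 < T → ∃ D₀ : ℝ → (ℝ → V → ℝ) → (ℝ → E → ℝ) → ℝ≥0∞,
      (∀ (ε : ℕ → Set.Ioi (0 : ℝ)) (ρn : ℕ → ℝ → V → ℝ) (jn : ℕ → ℝ → E → ℝ)
        (ρ : ℝ → V → ℝ) (j : ℝ → E → ℝ),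
        Tendsto (fun n => (ε n : ℝ)) atTop (𝓝 0) →
        (∀ n, G.CE T (ρn n) (jn n)) → G.CE T ρ j → ConvergesInCE T ρn jn ρ j →
        (∃ M : ℝ, ∀ n, ∀ t ∈ Set.Icc 0 T, (S (ε n)).energy (ρn n t) ≤ M) →
        ∀ τ ∈ Set.Ioc 0 T,
          D₀ τ ρ j ≤ liminf (fun n => (S (ε n)).dissipation τ (ρn n) (jn n)) atTop) ∧
      (∀ (ρ : ℝ → V → ℝ) (j : ℝ → E → ℝ), G.CE T ρ j →
        (∀ t ∈ Set.Icc 0 T, E₀ (ρ t) < ⊤) →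
        ∃ j' : ℝ → E' → ℝ, G'.CE T (fun t => restrictTo W (ρ t)) j' ∧
          ∀ τ ∈ Set.Ioc 0 T,
            D₀ τ ρ j = S'.dissipation τ (fun t => restrictTo W (ρ t)) j')

/-- EDP-convergence of gradient systems with tilting by potentials `F : V → ℝ`: for each `F`,
the system tilted by `F` EDP-converges. -/
def TiltEDPConverges {V E E' : Type*} [Fintype V] [Fintype E] [Fintype E']
    {G : EdgeGraph V E} {W : Finset V} {G' : EdgeGraph W E'}
    (S : (V → ℝ) → Set.Ioi (0 : ℝ) → GradSystem G) (S' : (V → ℝ) → GradSystem G') : Prop :=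
  ∀ F : V → ℝ, EDPConverges (S F) (S' F)

/-! ### Energies, and general facts about cosh systems -/

/-- Relative entropy of `ρ ≥ 0` with respect to a strictly positive measure `π`:
`∑ (u log u - u + 1) π` with `u = ρ / π`. -/
noncomputable def relEnt {V : Type*} [Fintype V] (ρ π : V → ℝ) : ℝ :=
  ∑ x, (ρ x / π x * Real.log (ρ x / π x) - ρ x / π x + 1) * π x

/-- The potential tilt `∑ ρ_x F_x`. -/
def potTilt {V : Type*} [Fintype V] (F ρ : V → ℝ) : ℝ := ∑ x, ρ x * F x

/-- The tilted density `u^F_x = (ρ_x / π_x) e^{F_x}`. -/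
noncomputable def tiltDensity {V : Type*} (π F ρ : V → ℝ) (x : V) : ℝ :=
  ρ x / π x * Real.exp (F x)

section CoshFacts

lemma hasFDerivAt_tiltedEnergy {V : Type*} [Fintype V] (π F ρ : V → ℝ) (hπ : ∀ x, 0 < π x)
    (hρ : ∀ x, 0 < ρ x) :
    HasFDerivAt (fun ρ => relEnt ρ π + potTilt F ρ)
      (∑ x, (Real.log (tiltDensity π F ρ x)) •
        ContinuousLinearMap.proj (R := ℝ) (φ := fun _ : V => ℝ) x) ρ := by
  have key : ∀ x, HasFDerivAt (fun ρ : V → ℝ =>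
      (ρ x / π x * Real.log (ρ x / π x) - ρ x / π x + 1) * π x + ρ x * F x)
      ((Real.log (tiltDensity π F ρ x)) •
        ContinuousLinearMap.proj (R := ℝ) (φ := fun _ : V => ℝ) x) ρ := by
    intro x
    have hpr : HasFDerivAt (fun ρ : V → ℝ => ρ x)
        (ContinuousLinearMap.proj (R := ℝ) (φ := fun _ : V => ℝ) x) ρ :=
      (ContinuousLinearMap.proj (R := ℝ) (φ := fun _ : V => ℝ) x).hasFDerivAt
    have hd : HasDerivAt (fun s : ℝ => (s / π x * Real.log (s / π x) - s / π x + 1) * π x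
        + s * F x) (Real.log (tiltDensity π F ρ x)) (ρ x) := by
      have hu : ρ x / π x ≠ 0 := (div_pos (hρ x) (hπ x)).ne'
      have h1 : HasDerivAt (fun s : ℝ => s / π x) (1 / π x) (ρ x) := (hasDerivAt_id _).div_const _
      have h2 := (h1.mul (h1.log hu)).sub h1
      have h3 := ((h2.add_const 1).mul_const (π x)).add ((hasDerivAt_id (ρ x)).mul_const (F x))
      refine h3.congr_deriv ?_
      unfold tiltDensity
      rw [Real.log_mul hu (Real.exp_pos _).ne', Real.log_exp]
      have := (hπ x).ne'
      have := (hρ x).ne'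
      field_simp
      ring
    exact hd.comp_hasFDerivAt ρ hpr
  have := HasFDerivAt.fun_sum (u := Finset.univ) (fun x _ => key x)
  refine this.congr_of_eventuallyEq (Eventually.of_forall fun ρ => ?_)
  simp only [relEnt, potTilt, Finset.sum_add_distrib]

lemma dualPotential_cosh {V E : Type*} [Fintype E] (σ : (V → ℝ) → E → ℝ) (ρ : V → ℝ)
    (hσ : ∀ e, 0 ≤ σ ρ e) (Ξ : E → ℝ) :
    dualPotential (fun ρ j => ∑ e, coshPersp (j e) (σ ρ e)) ρ Ξ
      = ((∑ e, σ ρ e * coshCStar (Ξ e) : ℝ) : EReal) := by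
  unfold dualPotential
  apply le_antisymm
  · refine iSup_le fun j => ?_
    have h : ENNReal.ofReal (∑ e, (j e * Ξ e - σ ρ e * coshCStar (Ξ e)))
        ≤ ∑ e, coshPersp (j e) (σ ρ e) := by
      calc _ ≤ ∑ e, ENNReal.ofReal (j e * Ξ e - σ ρ e * coshCStar (Ξ e)) := by
            classical
            induction (Finset.univ : Finset E) using Finset.induction_on with
            | empty => simp
            | insert a s ha ih =>
              rw [Finset.sum_insert ha, Finset.sum_insert ha]
              exact ENNReal.ofReal_add_le.trans (by gcongr)
        _ ≤ _ := Finset.sum_le_sum fun e _ => by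
            rw [mul_comm (j e)]; exact coshPersp_ge (hσ e) _ _
    beta_reduce
    by_cases hP : ∑ e, coshPersp (j e) (σ ρ e) = ⊤
    · rw [hP]; simp
    · lift (∑ e, coshPersp (j e) (σ ρ e)) to ℝ≥0 using hP with p hp
      rw [ENNReal.ofReal_le_coe, Finset.sum_sub_distrib] at h
      rw [show (((p : ℝ≥0∞) : EReal)) = ((p : ℝ) : EReal) from rfl, ← EReal.coe_sub,
        EReal.coe_le_coe_iff]
      linarith
  · refine le_trans (le_of_eq ?_) (le_iSup _ fun e => σ ρ e * (2 * Real.sinh (Ξ e / 2)))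
    have h : ∀ e, coshPersp (σ ρ e * (2 * Real.sinh (Ξ e / 2))) (σ ρ e) = ENNReal.ofReal
        (σ ρ e * (2 * Real.sinh (Ξ e / 2)) * Ξ e - σ ρ e * coshCStar (Ξ e)) ∧
        0 ≤ σ ρ e * (2 * Real.sinh (Ξ e / 2)) * Ξ e - σ ρ e * coshCStar (Ξ e) := by
      intro e
      have h1 : coshC (2 * Real.sinh (Ξ e / 2)) ≥ 0 := by
        have := coshC_fenchel (2 * Real.sinh (Ξ e / 2)) 0
        simpa [coshCStar] using this
      have h2 : σ ρ e * coshC (2 * Real.sinh (Ξ e / 2)) =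
          σ ρ e * (2 * Real.sinh (Ξ e / 2)) * Ξ e - σ ρ e * coshCStar (Ξ e) := by
        rw [coshC_fenchel_eq]; ring
      refine ⟨?_, h2 ▸ mul_nonneg (hσ e) h1⟩
      rcases (hσ e).eq_or_lt with h0 | hpos
      · simp [← h0, coshPersp]
      · rw [coshPersp, if_pos hpos, mul_div_cancel_left₀ _ hpos.ne', h2]
    have h' : (∑ e, coshPersp (σ ρ e * (2 * Real.sinh (Ξ e / 2))) (σ ρ e)) = ENNReal.ofReal
        (∑ e, (σ ρ e * (2 * Real.sinh (Ξ e / 2)) * Ξ e - σ ρ e * coshCStar (Ξ e))) := by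
      rw [ENNReal.ofReal_sum_of_nonneg fun e _ => (h e).2]
      exact Finset.sum_congr rfl fun e _ => (h e).1
    beta_reduce
    rw [h', EReal.coe_ennreal_ofReal, max_eq_left (Finset.sum_nonneg fun e _ => (h e).2),
      ← EReal.coe_sub, Finset.sum_sub_distrib]
    congr 1
    ring

/-- `√(pq) C*(log p - log q) = 2 (√p - √q)²`. -/
lemma coshCStar_log {p q : ℝ} (hp : 0 < p) (hq : 0 < q) :
    Real.sqrt (p * q) * coshCStar (Real.log p - Real.log q)
      = 2 * (Real.sqrt p - Real.sqrt q) ^ 2 := by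
  have ha := Real.sqrt_pos.mpr hp
  have hb := Real.sqrt_pos.mpr hq
  have e1 : Real.exp ((Real.log p - Real.log q) / 2) = Real.sqrt p / Real.sqrt q := by
    rw [show (Real.log p - Real.log q) / 2 = Real.log p / 2 - Real.log q / 2 by ring,
      Real.exp_sub, ← Real.log_sqrt hp.le, ← Real.log_sqrt hq.le, Real.exp_log ha,
      Real.exp_log hb]
  unfold coshCStar
  rw [Real.cosh_eq, Real.exp_neg, e1, Real.sqrt_mul hp.le]
  field_simp
  ring

lemma tiltDensity_pos {V : Type*} {π F ρ : V → ℝ} {x : V} (hπ : 0 < π x) (hρ : 0 < ρ x) :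
    0 < tiltDensity π F ρ x := mul_pos (div_pos hρ hπ) (Real.exp_pos _)

lemma convexOn_sum_coshPersp {E : Type*} [Fintype E] (σ : E → ℝ) (hσ : ∀ e, 0 ≤ σ e) :
    ConvexOn ℝ≥0 Set.univ fun j : E → ℝ => ∑ e, coshPersp (j e) (σ e) := by
  refine ⟨convex_univ, fun j _ j' _ c d _ _ h => ?_⟩
  rw [Finset.smul_sum, Finset.smul_sum, ← Finset.sum_add_distrib]
  exact Finset.sum_le_sum fun e _ => coshPersp_convex (hσ e) _ _ _ _ h

lemma lsc_sum_coshPersp {E : Type*} [Fintype E] (σ : E → ℝ) (hσ : ∀ e, 0 ≤ σ e) :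
    LowerSemicontinuous fun j : E → ℝ => ∑ e, coshPersp (j e) (σ e) :=
  lowerSemicontinuous_sum fun e _ => (coshPersp_lsc (hσ e)).comp (continuous_apply e)

end CoshFacts

/-! ### Two-terminal networks -/

/-- A detailed-balance Markov chain on the finite set `V` with strictly positive stationary
probability vector `π`, jump rates `κ` with connected graph, and two distinct terminals `a`, `b`. -/
structure TwoTerminalNetwork (V : Type*) [Fintype V] where
  π : V → ℝ
  κ : V → V → ℝ
  a : V
  b : V
  π_pos : ∀ x, 0 < π x
  π_sum : ∑ x, π x = 1
  κ_nonneg : ∀ x y, 0 ≤ κ x y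
  detailed_balance : ∀ x y, π x * κ x y = π y * κ y x
  connected : ∀ x y, Relation.ReflTransGen (fun x y => 0 < κ x y) x y
  a_ne_b : a ≠ b

namespace TwoTerminalNetwork

variable {V : Type*} [Fintype V] [DecidableEq V] (N : TwoTerminalNetwork V)

/-- The set of terminal nodes `{a, b}`. -/
def term : Finset V := {N.a, N.b}

/-- The edge set `{xy : κ_xy > 0}`. -/
def Edge : Type _ := {e : V × V // 0 < N.κ e.1 e.2}

noncomputable instance : Fintype N.Edge := by
  classical exact inferInstanceAs (Fintype {e : V × V // 0 < N.κ e.1 e.2})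

/-- The graph of the network. -/
def graph : EdgeGraph V N.Edge where
  src e := e.1.1
  tgt e := e.1.2

/-- The rescaled rates: jumps out of non-terminal nodes are accelerated by `1/ε`. -/
noncomputable def rate (ε : ℝ) (x y : V) : ℝ :=
  if x ∈ N.term then N.κ x y else ε⁻¹ * N.κ x y

/-- The normalization constant `Z^ε = π_a + π_b + ε ∑_{x non-terminal} π_x`. -/
noncomputable def Z (ε : ℝ) : ℝ := N.π N.a + N.π N.b + ε * ∑ x ∈ N.termᶜ, N.π x

/-- The stationary measure `π^ε` of the rescaled chain; `π^0` is its limit. -/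
noncomputable def stat (ε : ℝ) (x : V) : ℝ :=
  if x ∈ N.term then N.π x / N.Z ε else ε * N.π x / N.Z ε

/-- The tilted edge weights `k^{ε,F}_{xy} = π^ε_x κ^ε_{xy} e^{-(F_x + F_y)/2}`. -/
noncomputable def weight (ε : ℝ) (F : V → ℝ) (x y : V) : ℝ :=
  N.stat ε x * N.rate ε x y * Real.exp (-(F x + F y) / 2)

/-- The limiting tilted edge weights `k^F_{xy} = k^0_{xy} e^{-(F_x + F_y)/2}`, where
`k^0_{xy} = π_x κ_{xy} / (π_a + π_b)`. -/
noncomputable def limitWeight (F : V → ℝ) (x y : V) : ℝ :=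
  N.π x * N.κ x y / (N.π N.a + N.π N.b) * Real.exp (-(F x + F y) / 2)

/-- The effective capacity `cap^F_{ab}`, the infimum of `½ ∑_{xy} k^F_{xy} (h_y - h_x)²` over
`h` with `h_a = 1` and `h_b = 0`. -/
noncomputable def capacity (F : V → ℝ) : ℝ :=
  sInf {c | ∃ h : V → ℝ, h N.a = 1 ∧ h N.b = 0 ∧
    c = 1 / 2 * ∑ e : N.Edge, N.limitWeight F e.1.1 e.1.2 * |N.graph.grad h e| ^ 2}


lemma rate_nonneg {ε : ℝ} (hε : 0 < ε) (x y : V) : 0 ≤ N.rate ε x y := by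
  unfold rate
  have := N.κ_nonneg x y
  split_ifs
  · exact this
  · positivity

lemma Z_pos {ε : ℝ} (hε : 0 ≤ ε) : 0 < N.Z ε := by
  unfold Z
  have h1 := N.π_pos N.a
  have h2 := N.π_pos N.b
  have h3 : 0 ≤ ∑ x ∈ N.termᶜ, N.π x := Finset.sum_nonneg fun x _ => (N.π_pos x).le
  positivity

lemma stat_pos {ε : ℝ} (hε : 0 < ε) (x : V) : 0 < N.stat ε x := by
  unfold stat
  have := N.π_pos x
  have := N.Z_pos hε.le
  split_ifs <;> positivity

lemma stat_zero_pos (x : N.term) : 0 < N.stat 0 x := by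
  unfold stat
  rw [if_pos x.2]
  exact div_pos (N.π_pos x) (N.Z_pos le_rfl)

lemma stat_balance {ε : ℝ} (hε : 0 < ε) (x y : V) :
    N.stat ε x * N.rate ε x y = N.stat ε y * N.rate ε y x := by
  have key : ∀ x y, N.stat ε x * N.rate ε x y = N.π x * N.κ x y / N.Z ε := by
    intro x y
    unfold stat rate
    split_ifs
    · ring
    · field_simp
  rw [key, key, N.detailed_balance]

lemma capacity_nonneg (F : V → ℝ) : 0 ≤ N.capacity F := by
  refine Real.sInf_nonneg ?_
  rintro c ⟨h, -, -, rfl⟩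
  refine mul_nonneg (by norm_num) (Finset.sum_nonneg fun e _ => ?_)
  have h1 := N.π_pos e.1.1
  have h2 := N.κ_nonneg e.1.1 e.1.2
  have h3 := N.π_pos N.a
  have h4 := N.π_pos N.b
  unfold limitWeight
  positivity

lemma activity_eq {ε : ℝ} (hε : 0 < ε) (F ρ : V → ℝ) (x y : V) :
    1 / 2 * Real.sqrt (N.rate ε x y * N.rate ε y x * (ρ x * ρ y)) =
      1 / 2 * (N.weight ε F x y * Real.sqrt (tiltDensity (N.stat ε) F ρ x *
        tiltDensity (N.stat ε) F ρ y)) := by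
  have hx := N.stat_pos hε x
  have hy := N.stat_pos hε y
  have hb := N.stat_balance hε x y
  have hw : 0 ≤ N.weight ε F x y :=
    mul_nonneg (mul_nonneg hx.le (N.rate_nonneg hε x y)) (Real.exp_pos _).le
  congr 1
  rw [← Real.sqrt_sq hw, ← Real.sqrt_mul (sq_nonneg _)]
  congr 1
  have hE : Real.exp (-(F x + F y) / 2) ^ 2 * (Real.exp (F x) * Real.exp (F y)) = 1 := by
    rw [← Real.exp_add, sq, ← Real.exp_add, ← Real.exp_add, ← Real.exp_zero]
    congr 1
    ring
  unfold weight tiltDensity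
  calc N.rate ε x y * N.rate ε y x * (ρ x * ρ y)
      = (N.stat ε x * N.rate ε x y) * (N.stat ε y * N.rate ε y x) *
          (ρ x / N.stat ε x * (ρ y / N.stat ε y)) := by field_simp
    _ = (N.stat ε x * N.rate ε x y) ^ 2 * (ρ x / N.stat ε x * (ρ y / N.stat ε y)) *
          (Real.exp (-(F x + F y) / 2) ^ 2 * (Real.exp (F x) * Real.exp (F y))) := by
        rw [hE, ← hb]; ring
    _ = _ := by ring

/-- The gradient system at `ε > 0`, with tilt `F`: the energy is `H(ρ | π^ε) + ∑ ρ_x F_x`, and the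
dissipation potential is `∑_{xy} C(j_{xy} | ½ √(κ^ε_{xy} κ^ε_{yx} ρ_x ρ_y))`, whatever the tilt.
With `u = u^{ε,F}`, the dual term is `∑_{xy} k^{ε,F}_{xy} (√u_x - √u_y)²`. -/
noncomputable def system (F : V → ℝ) (ε : Set.Ioi (0 : ℝ)) : GradSystem N.graph where
  energy ρ := relEnt ρ (N.stat ε) + potTilt F ρ
  R ρ j := ∑ e : N.Edge, coshPersp (j e) (1 / 2 * Real.sqrt
    (N.rate ε e.1.1 e.1.2 * N.rate ε e.1.2 e.1.1 * (ρ e.1.1 * ρ e.1.2)))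
  convex_R ρ _ := convexOn_sum_coshPersp _ fun e => by positivity
  lsc_R ρ _ := lsc_sum_coshPersp _ fun e => by positivity
  R_zero ρ _ := by simp [coshPersp_zero]
  dualTerm ρ := ENNReal.ofReal (∑ e : N.Edge, N.weight ε F e.1.1 e.1.2 *
    (Real.sqrt (tiltDensity (N.stat ε) F ρ e.1.1)
      - Real.sqrt (tiltDensity (N.stat ε) F ρ e.1.2)) ^ 2)
  dualTerm_eq ρ hρ := by
    refine ⟨_, hasFDerivAt_tiltedEnergy (N.stat ε) F ρ (N.stat_pos ε.2) hρ, ?_⟩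
    rw [dualPotential_cosh (fun ρ (e : N.Edge) => 1 / 2 * Real.sqrt
      (N.rate ε e.1.1 e.1.2 * N.rate ε e.1.2 e.1.1 * (ρ e.1.1 * ρ e.1.2))) ρ
      (fun e => by positivity), EReal.coe_ennreal_ofReal, max_eq_left]
    · congr 1
      refine Finset.sum_congr rfl fun e _ => ?_
      rw [N.activity_eq ε.2 F ρ, EdgeGraph.grad, neg_sub, mul_assoc, mul_assoc]
      simp only [graph]
      rw [coshCStar_log (tiltDensity_pos (N.stat_pos ε.2 _) (hρ _))
        (tiltDensity_pos (N.stat_pos ε.2 _) (hρ _))]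
      ring
    · refine Finset.sum_nonneg fun e _ => mul_nonneg ?_ (sq_nonneg _)
      exact mul_nonneg (mul_nonneg (N.stat_pos ε.2 _).le (N.rate_nonneg ε.2 _ _))
        (Real.exp_pos _).le
  dualTerm_cont := by
    refine (ENNReal.continuous_ofReal.comp ?_).continuousOn
    unfold tiltDensity
    fun_prop

/-- The terminal node `a` of the limit graph. -/
def termA : N.term := ⟨N.a, by simp [term]⟩

/-- The terminal node `b` of the limit graph. -/
def termB : N.term := ⟨N.b, by simp [term]⟩

/-- The limit graph: nodes `{a, b}` and the single edge `ab`. -/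
def limitGraph : EdgeGraph N.term Unit where
  src _ := N.termA
  tgt _ := N.termB

/-- The tilted density `u^F` on `{a, b}` with respect to `π^0`. -/
noncomputable def limitDensity (F : V → ℝ) (ρ : N.term → ℝ) : N.term → ℝ :=
  tiltDensity (restrictTo N.term (N.stat 0)) (restrictTo N.term F) ρ

/-- The limit system with tilt `F`: the energy is `H(ρ | π^0) + ∑ ρ_x F_x` on `{a, b}`, and the
dissipation potential is `C(j_{ab} | cap^F_{ab} √(u^F_a u^F_b))`. The dual term is
`2 cap^F_{ab} (√u^F_a - √u^F_b)²`. -/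
noncomputable def limitSystem (F : V → ℝ) : GradSystem N.limitGraph where
  energy ρ := relEnt ρ (restrictTo N.term (N.stat 0)) + potTilt (restrictTo N.term F) ρ
  R ρ j := coshPersp (j ()) (N.capacity F *
    Real.sqrt (N.limitDensity F ρ N.termA * N.limitDensity F ρ N.termB))
  convex_R ρ _ := by
    have := convexOn_sum_coshPersp (fun _ : Unit => N.capacity F *
      Real.sqrt (N.limitDensity F ρ N.termA * N.limitDensity F ρ N.termB))
      (fun _ => mul_nonneg (N.capacity_nonneg F) (Real.sqrt_nonneg _))
    simpa using this
  lsc_R ρ _ := by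
    have := lsc_sum_coshPersp (fun _ : Unit => N.capacity F *
      Real.sqrt (N.limitDensity F ρ N.termA * N.limitDensity F ρ N.termB))
      (fun _ => mul_nonneg (N.capacity_nonneg F) (Real.sqrt_nonneg _))
    simpa using this
  R_zero ρ _ := coshPersp_zero _
  dualTerm ρ := ENNReal.ofReal (2 * N.capacity F *
    (Real.sqrt (N.limitDensity F ρ N.termA) - Real.sqrt (N.limitDensity F ρ N.termB)) ^ 2)
  dualTerm_eq ρ hρ := by
    refine ⟨_, hasFDerivAt_tiltedEnergy (restrictTo N.term (N.stat 0)) (restrictTo N.term F) ρ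
      N.stat_zero_pos hρ, ?_⟩
    have h := dualPotential_cosh (fun (ρ : N.term → ℝ) (_ : Unit) => N.capacity F *
      Real.sqrt (N.limitDensity F ρ N.termA * N.limitDensity F ρ N.termB)) ρ
      (fun _ => mul_nonneg (N.capacity_nonneg F) (Real.sqrt_nonneg _))
    simp only [Finset.univ_unique, Finset.sum_singleton, PUnit.default_eq_unit] at h
    rw [h, EReal.coe_ennreal_ofReal, max_eq_left]
    · congr 1
      rw [EdgeGraph.grad, neg_sub, mul_assoc (N.capacity F)]
      have hpos : ∀ x, 0 < N.limitDensity F ρ x :=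
        fun x => tiltDensity_pos (N.stat_zero_pos x) (hρ x)
      have := coshCStar_log (hpos N.termA) (hpos N.termB)
      simp only [limitGraph]
      change _ = N.capacity F * (Real.sqrt (N.limitDensity F ρ N.termA *
        N.limitDensity F ρ N.termB) * coshCStar (Real.log (N.limitDensity F ρ N.termA) -
          Real.log (N.limitDensity F ρ N.termB)))
      rw [this]
      ring
    · exact mul_nonneg (mul_nonneg (by norm_num) (N.capacity_nonneg F)) (sq_nonneg _)
  dualTerm_cont := by
    refine (ENNReal.continuous_ofReal.comp ?_).continuousOn
    unfold limitDensity tiltDensity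
    fun_prop

end TwoTerminalNetwork

/-! The energy part is superlinearity of the entropy. Since `π^ε_x → 0` at a non-terminal node,
bounded energy forces the mass there to vanish. At the terminals the reference weights converge to
positive numbers, so the entropy terms converge.

The dissipation only needs a lower bound, obtained by duality. By Fenchel's inequality and `2√(αβ) =
inf_l (e^l α + e^{-l} β)`, the limit integrand `C(s | c√(αβ)) + 2c(√α - √β)²` is the supremum over
two real parameters `ξ`, `l` of functions affine in `(s, α, β)` (`twoPointMinorant`). Affine
functions pass to weak limits, so it suffices to bound the `ε`-dissipation below by each of them.

For this, let `h` be the equilibrium potential, `P = h + e^{l+ξ/2}(1-h)` and `Q = h +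
e^{l-ξ/2}(1-h)`. Each edge is tested with the difference of `log P - log Q` along it. An
arithmetic-geometric mean inequality (`edge_dissipation_ge`) bounds the edge rate below by the flux
term plus the contribution of that edge to half the sum of the Dirichlet forms of `(P, u/P)` and
`(Q, u/Q)`. Both `P` and `Q` are affine in `h`, hence harmonic off the terminals, so these forms see
`u` only at `a` and `b` (`dirichletForm_equilibrium`). The interior densities, over which there is
no control as `ε ↓ 0`, drop out, and what remains is exactly the minorant with `c = cap^F`. The
factors `Z^0/Z^ε` cancel, so the bound is exact for every `ε` (`system_dissipation_rate_ge`).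

With `ξ`, `l` smooth and compactly supported in time, the bound passes to the limit. There the
continuity equation, with no mass off the terminals, turns the tested flux into `ξ` times the net
flux out of `a`, because `log P - log Q` rises from `0` at `a` to `ξ` at `b`. A measurable
near-optimal choice of `(ξ, l)` and mollification then bring the supremum under the time integral
(`lintegral_twoPoint_dissipation_le`). The tilt enters only through the weights and densities, so
one argument covers every `F`. -/

open scoped Convolution

/-! ### Duality for the two-point and the edge dissipation -/

/-- The affine minorants, in `(s, α, β)`, whose supremum over `ξ` and `l` is the integrand
`C(s | c √(αβ)) + 2 c (√α - √β)²` of the two-point dissipation. -/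
noncomputable def twoPointMinorant (c s α β ξ l : ℝ) : ℝ :=
  ξ * s + c * (2 * α + 2 * β - 2 * Real.cosh (ξ / 2) * (Real.exp l * α + Real.exp (-l) * β))

lemma twoPointMinorant_zero (c s α β : ℝ) : twoPointMinorant c s α β 0 0 = 0 := by
  simp [twoPointMinorant]; ring_nf; simp

lemma continuous_twoPointMinorant (c s α β : ℝ) :
    Continuous fun p : ℝ × ℝ => twoPointMinorant c s α β p.1 p.2 := by
  unfold twoPointMinorant
  fun_prop

/-- The infimum over `l` of `e^l α + e^{-l} β` is at most `2 √(αβ)`. -/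
lemma exists_exp_mul_add_lt {α β η : ℝ} (hα : 0 ≤ α) (hβ : 0 ≤ β) (hη : 0 < η) :
    ∃ l, Real.exp l * α + Real.exp (-l) * β < 2 * Real.sqrt (α * β) + η := by
  have tends : Tendsto (fun l : ℝ => Real.exp (-l)) atTop (𝓝 0) := Real.tendsto_exp_neg_atTop_nhds_zero
  -- If a density vanishes the infimum may fail to be attained, and `l` is sent to `+∞` or `-∞`.
  rcases hα.eq_or_lt with rfl | hα'
  · have h := tends.mul_const β
    rw [zero_mul] at h
    obtain ⟨l, hl⟩ := (h.eventually (gt_mem_nhds hη)).exists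
    exact ⟨l, by simpa using hl⟩
  rcases hβ.eq_or_lt with rfl | hβ'
  · have h := tends.mul_const α
    rw [zero_mul] at h
    obtain ⟨l, hl⟩ := (h.eventually (gt_mem_nhds hη)).exists
    exact ⟨-l, by simpa using hl⟩
  -- The exact minimizer, at which both summands equal `√(αβ)`.
  refine ⟨Real.log (Real.sqrt β / Real.sqrt α), ?_⟩
  have ha := Real.sqrt_pos.mpr hα'
  have hb := Real.sqrt_pos.mpr hβ'
  rw [Real.exp_neg, Real.exp_log (by positivity), Real.sqrt_mul hα]
  have e : Real.sqrt β / Real.sqrt α * α + (Real.sqrt β / Real.sqrt α)⁻¹ * β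
      = 2 * (Real.sqrt α * Real.sqrt β) := by
    rw [inv_div, div_mul_eq_mul_div, div_mul_eq_mul_div, mul_div_assoc, mul_div_assoc,
      Real.div_sqrt, Real.div_sqrt]
    ring
  linarith

/-- The integrand of the two-point dissipation is the supremum of `twoPointMinorant` over any dense
sequence of parameters. -/
lemma coshPersp_add_le_iSup_twoPointMinorant {c s α β : ℝ} (hc : 0 ≤ c) (hα : 0 ≤ α) (hβ : 0 ≤ β)
    {d : ℕ → ℝ × ℝ} (hd : DenseRange d) :
    coshPersp s (c * Real.sqrt (α * β))
        + ENNReal.ofReal (2 * c * (Real.sqrt α - Real.sqrt β) ^ 2)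
      ≤ ⨆ k, ENNReal.ofReal (twoPointMinorant c s α β (d k).1 (d k).2) := by
  have hsq : (Real.sqrt α - Real.sqrt β) ^ 2 = α + β - 2 * Real.sqrt (α * β) := by
    rw [Real.sqrt_mul hα, sub_sq, Real.sq_sqrt hα, Real.sq_sqrt hβ]; ring
  set D := 2 * c * (Real.sqrt α - Real.sqrt β) ^ 2 with hD
  have hD0 : 0 ≤ D := by positivity
  set S := ⨆ k, ENNReal.ofReal (twoPointMinorant c s α β (d k).1 (d k).2) with hS
  have hall : ∀ p : ℝ × ℝ, ENNReal.ofReal (twoPointMinorant c s α β p.1 p.2) ≤ S := by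
    intro p
    have hcl : IsClosed {p : ℝ × ℝ | ENNReal.ofReal (twoPointMinorant c s α β p.1 p.2) ≤ S} :=
      isClosed_le (ENNReal.continuous_ofReal.comp (continuous_twoPointMinorant c s α β))
        continuous_const
    refine hcl.closure_subset_iff.mpr ?_ (hd p)
    rintro _ ⟨k, rfl⟩
    exact le_iSup (fun k => ENNReal.ofReal (twoPointMinorant c s α β (d k).1 (d k).2)) k
  have hξ : ∀ ξ, ENNReal.ofReal (ξ * s - c * Real.sqrt (α * β) * coshCStar ξ + D) ≤ S := by
    intro ξ
    refine ENNReal.le_of_forall_pos_le_add fun η hη _ => ?_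
    have hch := Real.cosh_pos (ξ / 2)
    -- The tolerance gets multiplied by `2c cosh(ξ/2)` below; `c + 1` in place of `c` keeps the
    -- quotient meaningful when `c = 0`.
    obtain ⟨l, hl⟩ := exists_exp_mul_add_lt hα hβ
      (show 0 < (η : ℝ) / (2 * Real.cosh (ξ / 2) * (c + 1)) by positivity)
    have h1 : ξ * s - c * Real.sqrt (α * β) * coshCStar ξ + D
        ≤ twoPointMinorant c s α β ξ l + η := by
      have h2 := mul_le_mul_of_nonneg_left hl.le (show 0 ≤ c * (2 * Real.cosh (ξ / 2)) by positivity)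
      have h3 : c * (2 * Real.cosh (ξ / 2)) * ((η : ℝ) / (2 * Real.cosh (ξ / 2) * (c + 1))) ≤ η := by
        have : c * (2 * Real.cosh (ξ / 2)) * ((η : ℝ) / (2 * Real.cosh (ξ / 2) * (c + 1)))
          = η * (c / (c + 1)) := by field_simp
        rw [this]
        exact mul_le_of_le_one_right hη.le ((div_le_one (by positivity)).mpr (by linarith))
      rw [hD, hsq]
      unfold twoPointMinorant coshCStar
      nlinarith
    calc _ ≤ ENNReal.ofReal (twoPointMinorant c s α β ξ l + η) := ENNReal.ofReal_le_ofReal h1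
      _ ≤ ENNReal.ofReal (twoPointMinorant c s α β ξ l) + ENNReal.ofReal η :=
          ENNReal.ofReal_add_le
      _ ≤ S + η := by
          rw [ENNReal.ofReal_coe_nnreal]
          gcongr
          exact hall (ξ, l)
  rw [coshPersp_dual (by positivity), ENNReal.iSup_add]
  refine iSup_le fun ξ => ?_
  -- Positive parts are taken separately on the left. Where the flux part is negative only `D`
  -- survives, and `D` is the value at `ξ = 0`.
  rcases le_total 0 (ξ * s - c * Real.sqrt (α * β) * coshCStar ξ) with h | h
  · rw [← ENNReal.ofReal_add h hD0]
    exact hξ ξ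
  · rw [ENNReal.ofReal_of_nonpos h, zero_add]
    simpa [coshCStar] using hξ 0

/-- On one edge of weight `w`, with densities `u`, `v` at its end points, the dissipation rate
dominates an expression that is affine in the flux and the densities, for any two positive
functions, with the values `F₁, F₂` and `G₁, G₂` at the end points. -/
lemma edge_dissipation_ge {w u v F₁ F₂ G₁ G₂ : ℝ} (hw : 0 ≤ w) (hu : 0 ≤ u) (hv : 0 ≤ v)
    (hF₁ : 0 < F₁) (hF₂ : 0 < F₂) (hG₁ : 0 < G₁) (hG₂ : 0 < G₂) (j : ℝ) :
    ENNReal.ofReal (((Real.log F₂ - Real.log G₂) - (Real.log F₁ - Real.log G₁)) * j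
        + 1 / 2 * (w * (F₂ - F₁) * (v / F₂ - u / F₁) + w * (G₂ - G₁) * (v / G₂ - u / G₁)))
      ≤ coshPersp j (1 / 2 * (w * Real.sqrt (u * v)))
        + ENNReal.ofReal (w * (Real.sqrt u - Real.sqrt v) ^ 2) := by
  set ξ := (Real.log F₂ - Real.log G₂) - (Real.log F₁ - Real.log G₁) with hξ
  have hσ : 0 ≤ 1 / 2 * (w * Real.sqrt (u * v)) := by positivity
  refine le_trans ?_ (add_le_add_left (coshPersp_ge hσ j ξ) _)
  have hD : 0 ≤ w * (Real.sqrt u - Real.sqrt v) ^ 2 := by positivity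
  refine le_trans (ENNReal.ofReal_le_ofReal ?_) ENNReal.ofReal_add_le
  -- Only the ratios `F₂/F₁ = x²` and `G₂/G₁ = y²` matter, and then `2 cosh(ξ/2) = x/y + y/x`.
  obtain ⟨p, hp⟩ : ∃ p, F₂ = F₁ * Real.exp p :=
    ⟨Real.log (F₂ / F₁), by rw [Real.exp_log (by positivity)]; field_simp⟩
  obtain ⟨q, hq⟩ : ∃ q, G₂ = G₁ * Real.exp q :=
    ⟨Real.log (G₂ / G₁), by rw [Real.exp_log (by positivity)]; field_simp⟩
  have hξ' : ξ / 2 = p / 2 - q / 2 := by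
    rw [hξ, hp, hq, Real.log_mul hF₁.ne' (Real.exp_pos _).ne',
      Real.log_mul hG₁.ne' (Real.exp_pos _).ne', Real.log_exp, Real.log_exp]
    ring
  set x := Real.exp (p / 2) with hx
  set y := Real.exp (q / 2) with hy
  have hx0 : 0 < x := Real.exp_pos _
  have hy0 : 0 < y := Real.exp_pos _
  have ex : Real.exp p = x ^ 2 := by rw [hx, ← Real.exp_nat_mul]; congr 1; push_cast; ring
  have ey : Real.exp q = y ^ 2 := by rw [hy, ← Real.exp_nat_mul]; congr 1; push_cast; ring
  have hcosh : Real.cosh (ξ / 2) = (x / y + y / x) / 2 := by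
    rw [hξ', Real.cosh_eq, neg_sub, Real.exp_sub, Real.exp_sub]
  have eF : w * (F₂ - F₁) * (v / F₂ - u / F₁) = w * (v + u - v / x ^ 2 - u * x ^ 2) := by
    rw [hp, ex]; field_simp; ring
  have eG : w * (G₂ - G₁) * (v / G₂ - u / G₁) = w * (v + u - v / y ^ 2 - u * y ^ 2) := by
    rw [hq, ey]; field_simp; ring
  have hsq : (Real.sqrt u - Real.sqrt v) ^ 2 = u + v - 2 * Real.sqrt (u * v) := by
    rw [Real.sqrt_mul hu, sub_sq, Real.sq_sqrt hu, Real.sq_sqrt hv]; ring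
  -- The weight `xy` is chosen so that multiplying by `x/y + y/x` separates the result into the `F`
  -- terms and the `G` terms.
  have hAG : 2 * Real.sqrt (u * v) ≤ u * (x * y) + v / (x * y) := by
    have h0 : 0 < x * y := by positivity
    have h1 := two_mul_le_add_sq (Real.sqrt (u * (x * y))) (Real.sqrt (v / (x * y)))
    rw [Real.sq_sqrt (by positivity), Real.sq_sqrt (by positivity), mul_assoc,
      ← Real.sqrt_mul (by positivity)] at h1
    rwa [show u * (x * y) * (v / (x * y)) = u * v by field_simp] at h1
  have hmain := mul_le_mul_of_nonneg_left hAG (show 0 ≤ w * (x / y + y / x) / 2 by positivity)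
  have e : w * (x / y + y / x) / 2 * (u * (x * y) + v / (x * y))
      = w / 2 * (u * x ^ 2 + u * y ^ 2 + v / x ^ 2 + v / y ^ 2) := by
    field_simp
    ring
  rw [eF, eG, hsq, coshCStar, hcosh]
  rw [e] at hmain
  linarith

lemma ofReal_sum_le_sum_ofReal {ι : Type*} (s : Finset ι) (f : ι → ℝ) :
    ENNReal.ofReal (∑ i ∈ s, f i) ≤ ∑ i ∈ s, ENNReal.ofReal (f i) :=
  Finset.le_sum_of_subadditive _ ENNReal.ofReal_zero.le (fun _ _ => ENNReal.ofReal_add_le) s f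

/-! ### Capacity, equilibrium potential and the bound at fixed `ε` -/

namespace TwoTerminalNetwork

variable {V : Type*} [Fintype V] (N : TwoTerminalNetwork V)

lemma limitWeight_nonneg (F : V → ℝ) (x y : V) : 0 ≤ N.limitWeight F x y := by
  have h1 := N.π_pos x
  have h2 := N.κ_nonneg x y
  have h3 := N.π_pos N.a
  have h4 := N.π_pos N.b
  unfold limitWeight
  positivity

/-- The Dirichlet form of the network with the weights `limitWeight F`. -/
noncomputable def dirichletForm (F f g : V → ℝ) : ℝ :=
  ∑ e : N.Edge, N.limitWeight F e.1.1 e.1.2 * N.graph.grad f e * N.graph.grad g e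

lemma dirichletForm_add_left (F f f' g : V → ℝ) :
    N.dirichletForm F (f + f') g = N.dirichletForm F f g + N.dirichletForm F f' g := by
  simp only [dirichletForm, ← Finset.sum_add_distrib]
  refine Finset.sum_congr rfl fun e _ => ?_
  simp only [EdgeGraph.grad, Pi.add_apply]
  ring

lemma dirichletForm_smul_left (F f g : V → ℝ) (c : ℝ) :
    N.dirichletForm F (c • f) g = c * N.dirichletForm F f g := by
  simp only [dirichletForm, Finset.mul_sum]
  refine Finset.sum_congr rfl fun e _ => ?_
  simp only [EdgeGraph.grad, Pi.smul_apply, smul_eq_mul]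
  ring

lemma dirichletForm_comm (F f g : V → ℝ) : N.dirichletForm F f g = N.dirichletForm F g f := by
  simp only [dirichletForm]
  exact Finset.sum_congr rfl fun e _ => by ring

lemma dirichletForm_const_left (F g : V → ℝ) (c : ℝ) :
    N.dirichletForm F (fun _ => c) g = 0 := by
  simp [dirichletForm, EdgeGraph.grad]

/-- The admissible function `h`, with values in `[0, 1]`, that attains the capacity. -/
lemma exists_equilibrium_potential (F : V → ℝ) :
    ∃ h : V → ℝ, h N.a = 1 ∧ h N.b = 0 ∧ (∀ x, 0 ≤ h x ∧ h x ≤ 1) ∧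
      N.dirichletForm F h h = 2 * N.capacity F ∧
      ∀ g : V → ℝ, g N.a = 0 → g N.b = 0 → N.dirichletForm F h g = 0 := by
  classical
  have hb := N.a_ne_b
  set K : Set (V → ℝ) := Set.Icc 0 1 ∩ {h | h N.a = 1 ∧ h N.b = 0} with hK
  have hKc : IsCompact K := by
    refine isCompact_Icc.inter_right (IsClosed.inter ?_ ?_)
    · exact isClosed_eq (continuous_apply _) continuous_const
    · exact isClosed_eq (continuous_apply _) continuous_const
  have hKne : K.Nonempty := by
    refine ⟨Pi.single N.a 1, ⟨?_, ?_⟩, by simp, by simp [hb.symm]⟩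
    · intro x; by_cases hx : x = N.a
      · subst hx; simp
      · simp [hx]
    · intro x; by_cases hx : x = N.a
      · subst hx; simp
      · simp [hx]
  obtain ⟨h, ⟨⟨h0, h1⟩, ha, hb'⟩, hmin⟩ := hKc.exists_isMinOn hKne
    (f := fun h => N.dirichletForm F h h)
    (by unfold dirichletForm EdgeGraph.grad; fun_prop)
  -- Truncation to `[0, 1]` keeps the boundary values and shortens every increment, so the minimizer
  -- over the compact cube is a global one.
  have hglob : ∀ g : V → ℝ, g N.a = 1 → g N.b = 0 →
      N.dirichletForm F h h ≤ N.dirichletForm F g g := by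
    intro g ga gb
    have hm := hmin (a := fun x => max 0 (min 1 (g x)))
      ⟨⟨fun x => le_max_left _ _, fun x => max_le zero_le_one (min_le_left _ _)⟩,
        by simp [ga], by simp [gb]⟩
    refine le_trans hm (Finset.sum_le_sum fun e _ => ?_)
    rw [mul_assoc, mul_assoc]
    refine mul_le_mul_of_nonneg_left ?_ (N.limitWeight_nonneg F _ _)
    rw [← abs_mul_abs_self, ← abs_mul_abs_self (N.graph.grad g e)]
    have : |N.graph.grad (fun x => max 0 (min 1 (g x))) e| ≤ |N.graph.grad g e| := by
      unfold EdgeGraph.grad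
      refine (abs_max_sub_max_le_max 0 _ 0 _).trans (max_le (by simp) ?_)
      exact (abs_min_sub_min_le_max 1 _ 1 _).trans (max_le (by simp) le_rfl)
    exact mul_self_le_mul_self (abs_nonneg _) this
  refine ⟨h, ha, hb', fun x => ⟨h0 x, h1 x⟩, ?_, ?_⟩
  · have hcap : N.capacity F = 1 / 2 * N.dirichletForm F h h := by
      have habs : ∀ g : V → ℝ, ∑ e : N.Edge, N.limitWeight F e.1.1 e.1.2 *
          |N.graph.grad g e| ^ 2 = N.dirichletForm F g g := by
        intro g
        refine Finset.sum_congr rfl fun e _ => ?_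
        rw [sq_abs]; ring
      refine IsLeast.csInf_eq ⟨⟨h, ha, hb', by rw [habs]⟩, ?_⟩
      rintro c ⟨g, ga, gb, rfl⟩
      rw [habs]
      have := hglob g ga gb
      linarith
    rw [hcap]; ring
  · intro g ga gb
    -- First variation: this quadratic in `t` has no constant term, so its discriminant `4 E(h,g)²`
    -- can only be nonpositive if `E(h,g) = 0`.
    have hq : ∀ t : ℝ, 0 ≤ N.dirichletForm F g g * (t * t) + 2 * N.dirichletForm F h g * t + 0 := by
      intro t
      have := hglob (h + t • g) (by simp [ga, ha]) (by simp [gb, hb'])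
      rw [dirichletForm_add_left, dirichletForm_smul_left, N.dirichletForm_comm F h (h + t • g),
        N.dirichletForm_comm F g (h + t • g), dirichletForm_add_left, dirichletForm_add_left,
        dirichletForm_smul_left, dirichletForm_smul_left, N.dirichletForm_comm F g h] at this
      linarith
    have := discrim_le_zero hq
    unfold discrim at this
    nlinarith [sq_nonneg (N.dirichletForm F h g)]

/-- Constants carry no energy, so the left argument counts as `(1 - r) h`. Orthogonality of `h` to
functions vanishing at `a` and `b` then leaves only the terminal values of `g`. This is what removes
the interior densities from the estimate. -/
lemma dirichletForm_equilibrium {F h : V → ℝ} (ha : h N.a = 1) (hb : h N.b = 0)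
    (hh : N.dirichletForm F h h = 2 * N.capacity F)
    (hz : ∀ g : V → ℝ, g N.a = 0 → g N.b = 0 → N.dirichletForm F h g = 0) (r : ℝ) (g : V → ℝ) :
    N.dirichletForm F (fun x => h x + r * (1 - h x)) g
      = 2 * N.capacity F * (1 - r) * (g N.a - g N.b) := by
  -- Subtracting the combination of `h` and `1` with the boundary values of `g` gives an admissible
  -- test function.
  have h1 := hz (g + (-(g N.a - g N.b)) • h + fun _ => -g N.b) (by simp [ha]) (by simp [hb])
  rw [N.dirichletForm_comm, dirichletForm_add_left, dirichletForm_add_left,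
    dirichletForm_smul_left, dirichletForm_const_left, hh, N.dirichletForm_comm F g h] at h1
  have h2 : (fun x => h x + r * (1 - h x)) = ((1 - r) • h + fun _ => r : V → ℝ) := by
    funext x; simp; ring
  rw [h2, dirichletForm_add_left, dirichletForm_smul_left, dirichletForm_const_left]
  linear_combination (1 - r) * h1

/-- At non-terminal nodes the factor `ε` in `π^ε` cancels the acceleration `ε⁻¹` of the rates, so
`ε` survives only in the normalization. -/
lemma weight_eq [DecidableEq V] {ε : ℝ} (hε : 0 < ε) (F : V → ℝ) (x y : V) :
    N.weight ε F x y = N.Z 0 / N.Z ε * N.limitWeight F x y := by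
  have h0 : N.Z 0 = N.π N.a + N.π N.b := by simp [Z]
  have h1 := N.Z_pos le_rfl
  have h2 := N.Z_pos hε.le
  unfold weight limitWeight
  rw [← h0]
  have key : N.stat ε x * N.rate ε x y = N.π x * N.κ x y / N.Z ε := by
    unfold stat rate
    split_ifs
    · ring
    · field_simp
  rw [key]
  field_simp

lemma tiltDensity_stat_term [DecidableEq V] {ε : ℝ} (hε : 0 < ε) (F ρ : V → ℝ) {x : V}
    (hx : x ∈ N.term) :
    tiltDensity (N.stat 0) F ρ x = N.Z 0 / N.Z ε * tiltDensity (N.stat ε) F ρ x := by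
  have h1 := N.Z_pos le_rfl
  have h2 := N.Z_pos hε.le
  have h3 := N.π_pos x
  unfold tiltDensity stat
  rw [if_pos hx, if_pos hx]
  field_simp

/-- The dissipation rate at `ε > 0` dominates an expression that is affine in the flux and the
densities of the terminal nodes, for every choice of the parameters `ξ` and `l`. -/
lemma system_dissipation_rate_ge [DecidableEq V] {F h : V → ℝ} (ha : h N.a = 1) (hb : h N.b = 0)
    (h01 : ∀ x, 0 ≤ h x ∧ h x ≤ 1) (hh : N.dirichletForm F h h = 2 * N.capacity F)
    (hz : ∀ g : V → ℝ, g N.a = 0 → g N.b = 0 → N.dirichletForm F h g = 0)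
    (ε : Set.Ioi (0 : ℝ)) {ρ : V → ℝ} (hρ : 0 ≤ ρ) (j : N.Edge → ℝ) (ξ l : ℝ) :
    ENNReal.ofReal (∑ e, N.graph.grad (fun x => Real.log (h x + Real.exp (l + ξ / 2) * (1 - h x))
          - Real.log (h x + Real.exp (l - ξ / 2) * (1 - h x))) e * j e
        + twoPointMinorant (N.capacity F) 0 (tiltDensity (N.stat 0) F ρ N.a)
          (tiltDensity (N.stat 0) F ρ N.b) ξ l)
      ≤ (N.system F ε).R ρ j + (N.system F ε).dualTerm ρ := by
  have hε : (0 : ℝ) < ε := ε.2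
  set u := tiltDensity (N.stat ε) F ρ with hu
  have hu0 : ∀ x, 0 ≤ u x := fun x =>
    mul_nonneg (div_nonneg (hρ x) (N.stat_pos hε x).le) (Real.exp_pos _).le
  have hw0 : ∀ x y, 0 ≤ N.weight ε F x y := fun x y =>
    mul_nonneg (mul_nonneg (N.stat_pos hε x).le (N.rate_nonneg hε x y)) (Real.exp_pos _).le
  have hpos : ∀ r : ℝ, 0 < r → ∀ x, 0 < h x + r * (1 - h x) := by
    intro r hr x
    rcases (h01 x).1.eq_or_lt with h0 | h0
    · rw [← h0]; simpa
    · have := mul_nonneg hr.le (sub_nonneg.mpr (h01 x).2)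
      linarith
  set P : V → ℝ := fun x => h x + Real.exp (l + ξ / 2) * (1 - h x) with hP
  set Q : V → ℝ := fun x => h x + Real.exp (l - ξ / 2) * (1 - h x) with hQ
  have hP0 : ∀ x, 0 < P x := hpos _ (Real.exp_pos _)
  have hQ0 : ∀ x, 0 < Q x := hpos _ (Real.exp_pos _)
  -- With `r = e^{l±ξ/2}` each form is `2 cap (1-r)(u_a - u_b/r)`. The two values of `r` add up to
  -- `2 e^l cosh(ξ/2)` and their inverses to `2 e^{-l} cosh(ξ/2)`.
  have hmin : twoPointMinorant (N.capacity F) 0 (tiltDensity (N.stat 0) F ρ N.a)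
      (tiltDensity (N.stat 0) F ρ N.b) ξ l = 1 / 2 * (N.Z 0 / N.Z ε *
        (N.dirichletForm F P (fun x => u x / P x) + N.dirichletForm F Q fun x => u x / Q x)) := by
    rw [N.dirichletForm_equilibrium ha hb hh hz, N.dirichletForm_equilibrium ha hb hh hz,
      N.tiltDensity_stat_term hε F ρ (show N.a ∈ N.term by simp [term]),
      N.tiltDensity_stat_term hε F ρ (show N.b ∈ N.term by simp [term]), ← hu]
    simp only [hP, hQ, ha, hb, twoPointMinorant, Real.cosh_eq, Real.exp_add, Real.exp_sub,
      Real.exp_neg]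
    have h1 := Real.exp_pos l
    have h2 := Real.exp_pos (ξ / 2)
    field_simp
    ring
  have hsum : ∑ e, N.graph.grad (fun x => Real.log (P x) - Real.log (Q x)) e * j e
        + twoPointMinorant (N.capacity F) 0 (tiltDensity (N.stat 0) F ρ N.a)
          (tiltDensity (N.stat 0) F ρ N.b) ξ l
      = ∑ e : N.Edge, (((Real.log (P e.1.2) - Real.log (Q e.1.2))
          - (Real.log (P e.1.1) - Real.log (Q e.1.1))) * j e
        + 1 / 2 * (N.weight ε F e.1.1 e.1.2 * (P e.1.2 - P e.1.1)
            * (u e.1.2 / P e.1.2 - u e.1.1 / P e.1.1)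
          + N.weight ε F e.1.1 e.1.2 * (Q e.1.2 - Q e.1.1)
            * (u e.1.2 / Q e.1.2 - u e.1.1 / Q e.1.1))) := by
    rw [hmin, Finset.sum_add_distrib, ← Finset.mul_sum, dirichletForm, dirichletForm,
      ← Finset.sum_add_distrib, Finset.mul_sum]
    congr 2
    refine Finset.sum_congr rfl fun e _ => ?_
    simp only [N.weight_eq hε, EdgeGraph.grad, graph]
    ring
  rw [hsum]
  refine (ofReal_sum_le_sum_ofReal _ _).trans ?_
  change _ ≤ (∑ e : N.Edge, coshPersp (j e) (1 / 2 * Real.sqrt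
    (N.rate ε e.1.1 e.1.2 * N.rate ε e.1.2 e.1.1 * (ρ e.1.1 * ρ e.1.2)))) +
    ENNReal.ofReal (∑ e : N.Edge, N.weight ε F e.1.1 e.1.2 *
      (Real.sqrt (u e.1.1) - Real.sqrt (u e.1.2)) ^ 2)
  rw [ENNReal.ofReal_sum_of_nonneg fun e _ => mul_nonneg (hw0 _ _) (sq_nonneg _),
    ← Finset.sum_add_distrib]
  refine Finset.sum_le_sum fun e _ => ?_
  rw [N.activity_eq hε F ρ]
  exact edge_dissipation_ge (hw0 _ _) (hu0 _) (hu0 _) (hP0 _) (hP0 _) (hQ0 _) (hQ0 _) (j e)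

end TwoTerminalNetwork

/-! ### Localization: suprema of affine minorants under the time integral -/

/-- Integrability is not needed: the Bochner integral of a non-integrable function is `0`. -/
lemma ofReal_integral_le_lintegral_ofReal {X : Type*} [MeasurableSpace X] (μ : Measure X)
    (f : X → ℝ) : ENNReal.ofReal (∫ x, f x ∂μ) ≤ ∫⁻ x, ENNReal.ofReal (f x) ∂μ := by
  by_cases hf : Integrable f μ
  · rw [integral_eq_lintegral_pos_part_sub_lintegral_neg_part hf]
    exact (ENNReal.ofReal_le_ofReal (sub_le_self _ ENNReal.toReal_nonneg)).trans
      ENNReal.ofReal_toReal_le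
  · simp [integral_undef hf]

/-- Smooth approximation, boundedly and almost everywhere, of a bounded measurable function that
vanishes outside `[δ, T - δ]`. -/
lemma exists_smooth_approx {T δ K : ℝ} (hδ : 0 < δ) {f : ℝ → ℝ} (hf : Measurable f)
    (hK : ∀ t, |f t| ≤ K) (hsupp : ∀ t, t ∉ Set.Icc δ (T - δ) → f t = 0) :
    ∃ g : ℕ → ℝ → ℝ, (∀ n, ContDiff ℝ 1 (g n) ∧ HasCompactSupport (g n) ∧
      tsupport (g n) ⊆ Set.Ioo 0 T) ∧ (∀ n t, |g n t| ≤ 3 * K) ∧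
      ∀ᵐ t, Tendsto (fun n => g n t) atTop (𝓝 (f t)) := by
  have hint : LocallyIntegrable f := by
    refine (locallyIntegrable_const K).mono hf.aestronglyMeasurable (ae_of_all _ fun t => ?_)
    rw [Real.norm_eq_abs]
    exact (hK t).trans (le_abs_self K)
  -- Radii at most `δ/2` keep the supports inside `[δ/2, T - δ/2]`. The fixed ratio `rOut = 2 rIn`
  -- is what almost everywhere convergence of the convolutions requires.
  let φ : ℕ → ContDiffBump (0 : ℝ) := fun n =>
    ⟨δ / (4 * (n + 1)), δ / (2 * (n + 1)), by positivity, by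
      apply div_lt_div_of_pos_left hδ (by positivity)
      have : (0 : ℝ) < n + 1 := by positivity
      linarith⟩
  have hr : ∀ n, (φ n).rOut ≤ δ / 2 := fun n => by
    change δ / (2 * (n + 1)) ≤ δ / 2
    apply div_le_div_of_nonneg_left hδ.le (by norm_num)
    have : (0 : ℝ) ≤ n := by positivity
    linarith
  have hlim : Tendsto (fun n => (φ n).rOut) atTop (𝓝 0) := by
    have h1 := (tendsto_one_div_add_atTop_nhds_zero_nat (𝕜 := ℝ)).const_mul (δ / 2)
    rw [mul_zero] at h1
    refine h1.congr fun n => ?_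
    change δ / 2 * (1 / (n + 1)) = δ / (2 * (n + 1))
    field_simp
  let g : ℕ → ℝ → ℝ := fun n => (φ n).normed volume ⋆[ContinuousLinearMap.lsmul ℝ ℝ, volume] f
  have hsub : ∀ n, tsupport (g n) ⊆ Set.Icc (δ / 2) (T - δ / 2) := by
    intro n
    refine closure_minimal ?_ isClosed_Icc
    refine (support_convolution_subset _).trans ?_
    rintro _ ⟨x, hx, y, hy, rfl⟩
    rw [(φ n).support_normed_eq, Metric.mem_ball, dist_zero_right, Real.norm_eq_abs] at hx
    have hx' := abs_lt.mp (hx.trans_le (hr n))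
    have hy' : y ∈ Set.Icc δ (T - δ) := by
      by_contra h
      exact hy (hsupp y h)
    constructor <;> simp only <;> linarith [hy'.1, hy'.2, hx'.1, hx'.2]
  refine ⟨g, fun n => ⟨?_, ?_, ?_⟩, fun n t => ?_, ?_⟩
  · exact (φ n).hasCompactSupport_normed.contDiff_convolution_left _ (φ n).contDiff_normed hint
  · exact isCompact_Icc.of_isClosed_subset (isClosed_tsupport _) (hsub n)
  · exact (hsub n).trans fun t ht => ⟨by linarith [ht.1], by linarith [ht.2]⟩
  -- `2K` bounds the oscillation of `f`; adding `|f| ≤ K` gives `3K`.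
  · have h1 := (φ n).dist_normed_convolution_le (μ := volume) (x₀ := t) (ε := 2 * K)
      hf.aestronglyMeasurable (fun x _ => by
        rw [Real.dist_eq]
        have := abs_sub (f x) (f t)
        linarith [hK x, hK t])
    rw [Real.dist_eq] at h1
    have h2 := abs_sub_abs_le_abs_sub (g n t) (f t)
    have h3 := hK t
    change |g n t - f t| ≤ _ at h1
    linarith
  · refine ContDiffBump.ae_convolution_tendsto_right_of_locallyIntegrable (K := 2) hlim
      (Eventually.of_forall fun n => ?_) hint
    change δ / (2 * (n + 1)) ≤ 2 * (δ / (4 * (n + 1)))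
    apply le_of_eq
    field_simp
    norm_num

/-- An upper bound for `|twoPointMinorant c s α β ξ l|` when `|ξ|, |l| ≤ K`. -/
noncomputable def twoPointBound (K c s α β : ℝ) : ℝ :=
  K * |s| + |c| * (2 * |α| + 2 * |β|
    + 2 * Real.exp K * (Real.exp K * |α| + Real.exp K * |β|))

lemma abs_twoPointMinorant_le {K c s α β ξ l : ℝ} (hξ : |ξ| ≤ K) (hl : |l| ≤ K) :
    |twoPointMinorant c s α β ξ l| ≤ twoPointBound K c s α β := by
  have hK0 : 0 ≤ K := (abs_nonneg _).trans hξ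
  have e1 : Real.exp l ≤ Real.exp K := Real.exp_le_exp.mpr ((le_abs_self _).trans hl)
  have e2 : Real.exp (-l) ≤ Real.exp K := Real.exp_le_exp.mpr ((neg_le_abs _).trans hl)
  have e3 : Real.cosh (ξ / 2) ≤ Real.exp K := by
    rw [← Real.cosh_abs]
    have h1 : |ξ / 2| ≤ K := by
      rw [abs_div, abs_two]
      linarith [abs_nonneg ξ]
    refine le_trans ?_ (Real.exp_le_exp.mpr h1)
    rw [← Real.cosh_add_sinh]
    linarith [Real.sinh_nonneg_iff.mpr (abs_nonneg (ξ / 2))]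
  unfold twoPointMinorant twoPointBound
  have f1 : |Real.exp l * α + Real.exp (-l) * β| ≤ Real.exp K * |α| + Real.exp K * |β| := by
    refine (abs_add_le _ _).trans ?_
    rw [abs_mul, abs_mul, Real.abs_exp, Real.abs_exp]
    gcongr
  have f2 : |2 * Real.cosh (ξ / 2) * (Real.exp l * α + Real.exp (-l) * β)|
      ≤ 2 * Real.exp K * (Real.exp K * |α| + Real.exp K * |β|) := by
    rw [abs_mul, abs_mul, abs_two, abs_of_pos (Real.cosh_pos _)]
    gcongr
  refine (abs_add_le _ _).trans (add_le_add ?_ ?_)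
  · rw [abs_mul]
    exact mul_le_mul_of_nonneg_right hξ (abs_nonneg _)
  · rw [abs_mul]
    refine mul_le_mul_of_nonneg_left ?_ (abs_nonneg _)
    refine (abs_sub _ _).trans (add_le_add ((abs_add_le _ _).trans ?_) f2)
    rw [abs_mul, abs_mul, abs_two]

lemma integrable_twoPointBound {X : Type*} [MeasurableSpace X] {μ : Measure X} {s α β : X → ℝ}
    (hs : Integrable s μ) (hα : Integrable α μ) (hβ : Integrable β μ) (K c : ℝ) :
    Integrable (fun t => twoPointBound K c (s t) (α t) (β t)) μ := by
  have h1 := hs.abs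
  have h2 := hα.abs
  have h3 := hβ.abs
  exact (h1.const_mul K).add ((((h2.const_mul 2).add (h3.const_mul 2)).add
    (((h2.const_mul _).add (h3.const_mul _)).const_mul _)).const_mul |c|)

lemma aestronglyMeasurable_twoPointMinorant {X : Type*} [MeasurableSpace X] {μ : Measure X}
    {s α β ξ l : X → ℝ} (hs : AEStronglyMeasurable s μ) (hα : AEStronglyMeasurable α μ)
    (hβ : AEStronglyMeasurable β μ) (hξ : Measurable ξ) (hl : Measurable l) (c : ℝ) :
    AEStronglyMeasurable (fun t => twoPointMinorant c (s t) (α t) (β t) (ξ t) (l t)) μ := by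
  have h4 : AEStronglyMeasurable ξ μ := hξ.aestronglyMeasurable
  have h5 : AEStronglyMeasurable (fun t => Real.cosh (ξ t / 2)) μ :=
    (Real.measurable_cosh.comp (hξ.div_const 2)).aestronglyMeasurable
  have h6 : AEStronglyMeasurable (fun t => Real.exp (l t)) μ := hl.exp.aestronglyMeasurable
  have h7 : AEStronglyMeasurable (fun t => Real.exp (-l t)) μ := hl.neg.exp.aestronglyMeasurable
  exact (h4.mul hs).add (((hα.const_mul 2).add (hβ.const_mul 2)).sub
    ((h5.const_mul 2).mul ((h6.mul hα).add (h7.mul hβ))) |>.const_mul c)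

lemma tendsto_integral_twoPointMinorant {T c K : ℝ} {s α β : ℝ → ℝ}
    (hs : IntegrableOn s (Set.Icc 0 T)) (hα : IntegrableOn α (Set.Icc 0 T))
    (hβ : IntegrableOn β (Set.Icc 0 T)) {ξn ln : ℕ → ℝ → ℝ} {ξ l : ℝ → ℝ}
    (hξm : ∀ n, Measurable (ξn n)) (hlm : ∀ n, Measurable (ln n))
    (hξK : ∀ n t, |ξn n t| ≤ K) (hlK : ∀ n t, |ln n t| ≤ K)
    (hξ : ∀ᵐ t, t ∈ Set.Icc 0 T → Tendsto (fun n => ξn n t) atTop (𝓝 (ξ t)))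
    (hl : ∀ᵐ t, t ∈ Set.Icc 0 T → Tendsto (fun n => ln n t) atTop (𝓝 (l t))) :
    Tendsto (fun n => ∫ t in Set.Icc 0 T, twoPointMinorant c (s t) (α t) (β t) (ξn n t) (ln n t))
      atTop (𝓝 (∫ t in Set.Icc 0 T, twoPointMinorant c (s t) (α t) (β t) (ξ t) (l t))) := by
  refine tendsto_integral_of_dominated_convergence
    (fun t => twoPointBound K c (s t) (α t) (β t)) (fun n => ?_)
    (integrable_twoPointBound hs hα hβ K c)
    (fun n => ae_of_all _ fun t => abs_twoPointMinorant_le (hξK n t) (hlK n t)) ?_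
  · exact aestronglyMeasurable_twoPointMinorant hs.aestronglyMeasurable hα.aestronglyMeasurable
      hβ.aestronglyMeasurable (hξm n) (hlm n) c
  · rw [ae_restrict_iff' measurableSet_Icc]
    filter_upwards [hξ, hl] with t h1 h2 ht
    exact ((continuous_twoPointMinorant c (s t) (α t) (β t)).tendsto (ξ t, l t)).comp
      ((h1 ht).prodMk_nhds (h2 ht))

/-- An upper bound for the integrals of the affine minorants with smooth, compactly supported
parameters extends to bounded measurable parameters. -/
lemma ofReal_integral_twoPointMinorant_le {T c : ℝ} {s α β : ℝ → ℝ} {B : ℝ≥0∞}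
    (hs : IntegrableOn s (Set.Icc 0 T)) (hα : IntegrableOn α (Set.Icc 0 T))
    (hβ : IntegrableOn β (Set.Icc 0 T))
    (hB : ∀ ξ l : ℝ → ℝ,
      (ContDiff ℝ 1 ξ ∧ HasCompactSupport ξ ∧ tsupport ξ ⊆ Set.Ioo 0 T) →
      (ContDiff ℝ 1 l ∧ HasCompactSupport l ∧ tsupport l ⊆ Set.Ioo 0 T) →
      ENNReal.ofReal (∫ t in Set.Icc 0 T, twoPointMinorant c (s t) (α t) (β t) (ξ t) (l t)) ≤ B)
    {ξ l : ℝ → ℝ} {K : ℝ} (hξ : Measurable ξ) (hl : Measurable l) (hξK : ∀ t, |ξ t| ≤ K)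
    (hlK : ∀ t, |l t| ≤ K) :
    ENNReal.ofReal (∫ t in Set.Icc 0 T, twoPointMinorant c (s t) (α t) (β t) (ξ t) (l t)) ≤ B := by
  -- Parameters are first cut off near `0` and `T`, which leaves room to mollify, and then `δ ↓ 0`.
  have step : ∀ δ : ℝ, 0 < δ → ENNReal.ofReal (∫ t in Set.Icc 0 T, twoPointMinorant c (s t) (α t)
      (β t) ((Set.Icc δ (T - δ)).indicator ξ t) ((Set.Icc δ (T - δ)).indicator l t)) ≤ B := by
    intro δ hδ
    have hind : ∀ f : ℝ → ℝ, (∀ t, |f t| ≤ K) →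
        ∀ t, |(Set.Icc δ (T - δ)).indicator f t| ≤ K := fun f hf t => by
      by_cases ht : t ∈ Set.Icc δ (T - δ)
      · simpa [ht] using hf t
      · simpa [ht] using (abs_nonneg _).trans (hf t)
    obtain ⟨ξn, h1, h2, h3⟩ := exists_smooth_approx hδ (hξ.indicator measurableSet_Icc)
      (hind ξ hξK) (fun t ht => Set.indicator_of_notMem ht _)
    obtain ⟨ln, h1', h2', h3'⟩ := exists_smooth_approx hδ (hl.indicator measurableSet_Icc)
      (hind l hlK) (fun t ht => Set.indicator_of_notMem ht _)
    have hlim := tendsto_integral_twoPointMinorant (c := c) hs hα hβ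
      (fun n => (h1 n).1.continuous.measurable) (fun n => (h1' n).1.continuous.measurable) h2 h2'
      (h3.mono fun t ht _ => ht) (h3'.mono fun t ht _ => ht)
    exact le_of_tendsto (ENNReal.tendsto_ofReal hlim)
      (Eventually.of_forall fun n => hB _ _ (h1 n) (h1' n))
  set S : ℕ → Set ℝ := fun n => Set.Icc (1 / ((n : ℝ) + 1)) (T - 1 / ((n : ℝ) + 1)) with hS
  have hconv : ∀ f : ℝ → ℝ, ∀ᵐ t, t ∈ Set.Icc 0 T →
      Tendsto (fun n => (S n).indicator f t) atTop (𝓝 (f t)) := by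
    intro f
    filter_upwards [Measure.ae_ne volume 0, Measure.ae_ne volume T] with t h0 hT ht
    have hpos : 0 < min t (T - t) := lt_min (lt_of_le_of_ne ht.1 (Ne.symm h0))
      (sub_pos.mpr (lt_of_le_of_ne ht.2 hT))
    have hev := (tendsto_one_div_add_atTop_nhds_zero_nat (𝕜 := ℝ)).eventually (gt_mem_nhds hpos)
    refine tendsto_const_nhds.congr' ?_
    filter_upwards [hev] with n hn
    rw [lt_min_iff] at hn
    exact (Set.indicator_of_mem (show t ∈ S n from ⟨hn.1.le, by linarith [hn.2]⟩) f).symm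
  have hind : ∀ f : ℝ → ℝ, (∀ t, |f t| ≤ K) → ∀ n t, |(S n).indicator f t| ≤ K :=
    fun f hf n t => by
      by_cases ht : t ∈ S n
      · simpa [ht] using hf t
      · simpa [ht] using (abs_nonneg _).trans (hf t)
  have hlim := tendsto_integral_twoPointMinorant (c := c) hs hα hβ
    (fun n => hξ.indicator (s := S n) measurableSet_Icc)
    (fun n => hl.indicator (s := S n) measurableSet_Icc)
    (hind ξ hξK) (hind l hlK) (hconv ξ) (hconv l)
  exact le_of_tendsto (ENNReal.tendsto_ofReal hlim)
    (Eventually.of_forall fun n => step _ (by positivity))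

/-- Running maximum over the first `n` parameters `d 0, …, d (n - 1)`, starting from `(0, 0)`. -/
noncomputable def runningArgmax (m : ℝ → ℝ × ℝ → ℝ) (d : ℕ → ℝ × ℝ) : ℕ → ℝ → ℝ × ℝ
  | 0, _ => 0
  | n + 1, t =>
    if m t (runningArgmax m d n t) < m t (d n) then d n else runningArgmax m d n t

lemma le_runningArgmax_succ (m : ℝ → ℝ × ℝ → ℝ) (d : ℕ → ℝ × ℝ) (n : ℕ) (t : ℝ) :
    m t (runningArgmax m d n t) ≤ m t (runningArgmax m d (n + 1) t) ∧
      m t (d n) ≤ m t (runningArgmax m d (n + 1) t) := by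
  rw [runningArgmax]
  split_ifs with h
  · exact ⟨h.le, le_rfl⟩
  · exact ⟨le_rfl, not_lt.mp h⟩

lemma measurable_runningArgmax {m : ℝ → ℝ × ℝ → ℝ} (hm : Measurable (Function.uncurry m))
    (d : ℕ → ℝ × ℝ) (n : ℕ) : Measurable (runningArgmax m d n) := by
  induction n with
  | zero => exact measurable_const
  | succ n ih =>
    refine Measurable.ite (measurableSet_lt ?_ ?_) measurable_const ih
    · exact hm.comp (measurable_id.prodMk ih)
    · exact hm.comp (measurable_id.prodMk measurable_const)

/-- Finitely many values are taken; the bound may grow with `n`, since each `n` is treated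
separately. -/
lemma exists_bound_runningArgmax (m : ℝ → ℝ × ℝ → ℝ) (d : ℕ → ℝ × ℝ) (n : ℕ) :
    ∃ K, ∀ t, ‖runningArgmax m d n t‖ ≤ K := by
  induction n with
  | zero => exact ⟨0, fun t => by simp [runningArgmax]⟩
  | succ n ih =>
    obtain ⟨K, hK⟩ := ih
    refine ⟨max K ‖d n‖, fun t => ?_⟩
    rw [runningArgmax]
    split_ifs
    · exact le_max_right _ _
    · exact (hK t).trans (le_max_left _ _)

/-- The two-point dissipation is bounded by any bound for the integrals of its affine minorants
with smooth, compactly supported parameters. -/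
lemma lintegral_twoPoint_dissipation_le {T c : ℝ} (hc : 0 ≤ c) {s α β : ℝ → ℝ} {B : ℝ≥0∞}
    (hs : IntegrableOn s (Set.Icc 0 T)) (hα : IntegrableOn α (Set.Icc 0 T))
    (hβ : IntegrableOn β (Set.Icc 0 T)) (hα0 : ∀ t ∈ Set.Icc 0 T, 0 ≤ α t)
    (hβ0 : ∀ t ∈ Set.Icc 0 T, 0 ≤ β t)
    (hB : ∀ ξ l : ℝ → ℝ,
      (ContDiff ℝ 1 ξ ∧ HasCompactSupport ξ ∧ tsupport ξ ⊆ Set.Ioo 0 T) →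
      (ContDiff ℝ 1 l ∧ HasCompactSupport l ∧ tsupport l ⊆ Set.Ioo 0 T) →
      ENNReal.ofReal (∫ t in Set.Icc 0 T, twoPointMinorant c (s t) (α t) (β t) (ξ t) (l t)) ≤ B) :
    ∫⁻ t in Set.Icc 0 T, (coshPersp (s t) (c * Real.sqrt (α t * β t))
      + ENNReal.ofReal (2 * c * (Real.sqrt (α t) - Real.sqrt (β t)) ^ 2)) ≤ B := by
  set μ := volume.restrict (Set.Icc 0 T) with hμ
  -- Measurable representatives make the selection of parameters genuinely measurable in `t`.
  obtain ⟨s', hs', es⟩ := hs.aemeasurable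
  obtain ⟨α', hα', eα⟩ := hα.aemeasurable
  obtain ⟨β', hβ', eβ⟩ := hβ.aemeasurable
  set m : ℝ → ℝ × ℝ → ℝ := fun t p => twoPointMinorant c (s' t) (α' t) (β' t) p.1 p.2 with hm
  have hmm : Measurable (Function.uncurry m) := by
    unfold m twoPointMinorant Function.uncurry
    have h5 : Measurable fun p : ℝ × ℝ × ℝ => Real.cosh (p.2.1 / 2) := by fun_prop
    fun_prop
  set d : ℕ → ℝ × ℝ := TopologicalSpace.denseSeq (ℝ × ℝ) with hd
  set ζ := runningArgmax m d with hζ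
  have hζm : ∀ n, Measurable (ζ n) := measurable_runningArgmax hmm d
  have hmono : ∀ t, Monotone fun n => m t (ζ n t) := fun t =>
    monotone_nat_of_le_succ fun n => (le_runningArgmax_succ m d n t).1
  -- Starting the running maximum at `(0, 0)`, where the minorant is `0`, keeps it nonnegative, so
  -- `ofReal` commutes with the integral below.
  have hnonneg : ∀ n t, 0 ≤ m t (ζ n t) := fun n t => by
    have h0 : m t (ζ 0 t) = 0 := by
      simp only [hζ, runningArgmax, hm]
      exact twoPointMinorant_zero _ _ _ _
    exact h0 ▸ hmono t (Nat.zero_le n)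
  have hle : ∫⁻ t, (coshPersp (s t) (c * Real.sqrt (α t * β t))
      + ENNReal.ofReal (2 * c * (Real.sqrt (α t) - Real.sqrt (β t)) ^ 2)) ∂μ
      ≤ ∫⁻ t, ⨆ n, ENNReal.ofReal (m t (ζ n t)) ∂μ := by
    refine lintegral_mono_ae ?_
    filter_upwards [es, eα, eβ, ae_restrict_mem measurableSet_Icc] with t h1 h2 h3 ht
    refine (coshPersp_add_le_iSup_twoPointMinorant hc (hα0 t ht) (hβ0 t ht)
      (TopologicalSpace.denseRange_denseSeq (ℝ × ℝ))).trans (iSup_le fun k => ?_)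
    refine le_trans ?_ (le_iSup _ (k + 1))
    rw [h1, h2, h3]
    exact ENNReal.ofReal_le_ofReal (le_runningArgmax_succ m d k t).2
  refine hle.trans ?_
  rw [lintegral_iSup]
  rotate_left
  · exact fun n => (hmm.comp (measurable_id.prodMk (hζm n))).ennreal_ofReal
  · exact fun n n' h t => ENNReal.ofReal_le_ofReal (hmono t h)
  refine iSup_le fun n => ?_
  obtain ⟨K, hK⟩ := exists_bound_runningArgmax m d n
  have h1 := ofReal_integral_twoPointMinorant_le hs hα hβ hB (hζm n).fst (hζm n).snd
    (fun t => (norm_fst_le (ζ n t)).trans (hK t)) (fun t => (norm_snd_le (ζ n t)).trans (hK t))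
  refine le_trans (le_of_eq ?_) h1
  have hcongr : (fun t => twoPointMinorant c (s t) (α t) (β t) (ζ n t).1 (ζ n t).2)
      =ᵐ[μ] fun t => m t (ζ n t) := by
    filter_upwards [es, eα, eβ] with t h1 h2 h3
    rw [h1, h2, h3]
  rw [integral_congr_ae hcongr]
  refine (ofReal_integral_eq_lintegral_ofReal ?_ (ae_of_all _ (hnonneg n))).symm
  refine Integrable.congr ?_ hcongr
  refine (integrable_twoPointBound hs hα hβ K c).mono'
    (aestronglyMeasurable_twoPointMinorant hs.aestronglyMeasurable hα.aestronglyMeasurable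
      hβ.aestronglyMeasurable (hζm n).fst (hζm n).snd c)
    (ae_of_all _ fun t => abs_twoPointMinorant_le ?_ ?_)
  · exact (norm_fst_le (ζ n t)).trans (hK t)
  · exact (norm_snd_le (ζ n t)).trans (hK t)

/-! ### The continuity equation -/

lemma setIntegral_Icc_of_eq_zero {τ T : ℝ} (hτ : τ ≤ T) {f : ℝ → ℝ}
    (hf : ∀ t, t ∉ Set.Ioo 0 τ → f t = 0) :
    ∫ t in Set.Icc 0 T, f t = ∫ t in Set.Icc 0 τ, f t := by
  refine setIntegral_eq_of_subset_of_forall_sdiff_eq_zero measurableSet_Icc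
    (Set.Icc_subset_Icc_right hτ) fun t ht => hf t fun h => ht.2 (Set.Ioo_subset_Icc_self h)

lemma deriv_eq_zero_of_notMem_tsupport {f : ℝ → ℝ} {t : ℝ} (ht : t ∉ tsupport f) :
    deriv f t = 0 := by
  have h : f =ᶠ[𝓝 t] fun _ => 0 := notMem_tsupport_iff_eventuallyEq.mp ht
  rw [h.deriv_eq]
  simp

/-- Curves in `CE(0,T)` restrict to curves in `CE(0,τ)`. -/
lemma EdgeGraph.CE.mono {V E : Type*} [Fintype V] [Fintype E] {G : EdgeGraph V E} {T τ : ℝ}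
    {ρ : ℝ → V → ℝ} {j : ℝ → E → ℝ} (h : G.CE T ρ j) (hτ : τ ≤ T) : G.CE τ ρ j where
  nonneg t ht := h.nonneg t (Set.Icc_subset_Icc_right hτ ht)
  continuousOn := h.continuousOn.mono (Set.Icc_subset_Icc_right hτ)
  integrableOn e := (h.integrableOn e).mono_set (Set.Icc_subset_Icc_right hτ)
  weak φ hφ := by
    have h0 : ∀ t, t ∉ Set.Ioo 0 τ → ∀ x, t ∉ tsupport (φ x) := fun t ht x hx =>
      ht ((hφ x).2.2 hx)
    rw [← setIntegral_Icc_of_eq_zero hτ, ← setIntegral_Icc_of_eq_zero hτ]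
    · exact h.weak φ fun x => ⟨(hφ x).1, (hφ x).2.1,
        (hφ x).2.2.trans (Set.Ioo_subset_Ioo_right hτ)⟩
    · intro t ht
      refine Finset.sum_eq_zero fun e _ => ?_
      rw [EdgeGraph.grad, image_eq_zero_of_notMem_tsupport (h0 t ht _),
        image_eq_zero_of_notMem_tsupport (h0 t ht _)]
      simp
    · intro t ht
      refine Finset.sum_eq_zero fun x _ => ?_
      rw [deriv_eq_zero_of_notMem_tsupport (h0 t ht x), zero_mul]

lemma EdgeGraph.CE.integrableOn_rho {V E : Type*} [Fintype V] [Fintype E] {G : EdgeGraph V E}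
    {T : ℝ} {ρ : ℝ → V → ℝ} {j : ℝ → E → ℝ} (h : G.CE T ρ j) (x : V) :
    IntegrableOn (fun t => ρ t x) (Set.Icc 0 T) :=
  ((continuous_apply x).comp_continuousOn h.continuousOn).integrableOn_Icc

lemma integrableOn_continuous_mul {T : ℝ} {φ f : ℝ → ℝ} (hφ : Continuous φ)
    (hf : IntegrableOn f (Set.Icc 0 T)) : IntegrableOn (fun t => φ t * f t) (Set.Icc 0 T) :=
  hf.continuousOn_mul hφ.continuousOn isCompact_Icc

/-! ### Entropy -/

/-- Fenchel's inequality for `u log u - u + 1`, whose dual is `e^l - 1`. Since `l` is free it gives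
linear growth in `ρ` of any slope, at a cost proportional to `π`. -/
lemma entropy_term_ge {π ρ : ℝ} (hπ : 0 < π) (hρ : 0 ≤ ρ) (l : ℝ) :
    l * ρ - (Real.exp l - 1) * π ≤ (ρ / π * Real.log (ρ / π) - ρ / π + 1) * π := by
  obtain ⟨u, rfl⟩ : ∃ u, ρ = u * π := ⟨ρ / π, by field_simp⟩
  rw [mul_div_cancel_right₀ _ hπ.ne']
  have hu : 0 ≤ u := nonneg_of_mul_nonneg_left hρ hπ
  have key : l * u - (Real.exp l - 1) ≤ u * Real.log u - u + 1 := by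
    rcases hu.eq_or_lt with rfl | hu
    · simp [(Real.exp_pos l).le]
    · have h1 := mul_le_mul_of_nonneg_left (Real.add_one_le_exp (l - Real.log u)) hu.le
      rw [Real.exp_sub, Real.exp_log hu, mul_div_cancel₀ _ hu.ne'] at h1
      linarith
  have := mul_le_mul_of_nonneg_right key hπ.le
  linarith

lemma tendsto_entropy_term {πn ρn : ℕ → ℝ} {π ρ : ℝ} (hπ : 0 < π)
    (hπn : Tendsto πn atTop (𝓝 π)) (hρn : Tendsto ρn atTop (𝓝 ρ)) :
    Tendsto (fun n => (ρn n / πn n * Real.log (ρn n / πn n) - ρn n / πn n + 1) * πn n) atTop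
      (𝓝 ((ρ / π * Real.log (ρ / π) - ρ / π + 1) * π)) := by
  have h1 := hρn.div hπn hπ.ne'
  have h2 := (Real.continuous_mul_log.tendsto (ρ / π)).comp h1
  exact ((h2.sub h1).add_const 1).mul hπn

/-! ### Space-time test potentials -/

/-- The node potentials used to test the flux. -/
noncomputable def testPotential {V : Type*} (h : V → ℝ) (ξ l : ℝ → ℝ) (x : V) (t : ℝ) : ℝ :=
  Real.log (h x + Real.exp (l t + ξ t / 2) * (1 - h x))
    - Real.log (h x + Real.exp (l t - ξ t / 2) * (1 - h x))

/-- Where `ξ = l = 0` both logarithms are `log 1`, so the support lies in that of `ξ` and `l`; `0 ≤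
h ≤ 1` keeps the arguments positive. -/
lemma testPotential_spec {V : Type*} {h : V → ℝ} (h01 : ∀ x, 0 ≤ h x ∧ h x ≤ 1) {ξ l : ℝ → ℝ} {T : ℝ}
    (hξ : ContDiff ℝ 1 ξ ∧ HasCompactSupport ξ ∧ tsupport ξ ⊆ Set.Ioo 0 T)
    (hl : ContDiff ℝ 1 l ∧ HasCompactSupport l ∧ tsupport l ⊆ Set.Ioo 0 T) (x : V) :
    ContDiff ℝ 1 (testPotential h ξ l x) ∧ HasCompactSupport (testPotential h ξ l x) ∧
      tsupport (testPotential h ξ l x) ⊆ Set.Ioo 0 T := by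
  have hpos : ∀ r : ℝ, h x + Real.exp r * (1 - h x) ≠ 0 := by
    intro r
    have hr := Real.exp_pos r
    rcases (h01 x).1.eq_or_lt with h0 | h0
    · rw [← h0]; simp
    · have := mul_nonneg hr.le (sub_nonneg.mpr (h01 x).2)
      linarith
  have hsub : tsupport (testPotential h ξ l x) ⊆ tsupport ξ ∪ tsupport l := by
    refine closure_minimal (fun t ht => ?_) ((isClosed_tsupport _).union (isClosed_tsupport _))
    by_contra hc
    rw [Set.mem_union, not_or] at hc
    refine ht ?_
    simp [testPotential, image_eq_zero_of_notMem_tsupport hc.1,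
      image_eq_zero_of_notMem_tsupport hc.2]
  refine ⟨?_, (hξ.2.1.isCompact.union hl.2.1.isCompact).of_isClosed_subset (isClosed_tsupport _)
    hsub, hsub.trans (Set.union_subset hξ.2.2 hl.2.2)⟩
  have h1 := hξ.1
  have h2 := hl.1
  refine ContDiff.sub (ContDiff.log ?_ fun t => hpos _) (ContDiff.log ?_ fun t => hpos _) <;>
    fun_prop

lemma testPotential_terminals {V : Type*} [Fintype V] (N : TwoTerminalNetwork V) {h : V → ℝ}
    (ha : h N.a = 1) (hb : h N.b = 0) (ξ l : ℝ → ℝ) (t : ℝ) :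
    testPotential h ξ l N.b t - testPotential h ξ l N.a t = ξ t := by
  simp [testPotential, ha, hb]

/-! ### Γ-convergence of the energies and vanishing of interior mass -/

namespace TwoTerminalNetwork

variable {V : Type*} [Fintype V] [DecidableEq V] (N : TwoTerminalNetwork V)

lemma sum_restrictTo_of_eq_zero {f : V → ℝ} (hf : ∀ x, x ∉ N.term → f x = 0) :
    ∑ x : N.term, f x = ∑ x, f x := by
  rw [Finset.sum_coe_sort N.term f]
  exact Finset.sum_subset (Finset.subset_univ _) fun x _ hx => hf x hx

lemma tendsto_stat {ε : ℕ → Set.Ioi (0 : ℝ)} (hε : Tendsto (fun n => (ε n : ℝ)) atTop (𝓝 0))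
    (x : V) : Tendsto (fun n => N.stat (ε n) x) atTop (𝓝 (N.stat 0 x)) := by
  have hZ : Tendsto (fun n => N.Z (ε n)) atTop (𝓝 (N.Z 0)) :=
    (hε.mul_const _).const_add _
  unfold stat
  split_ifs
  · exact tendsto_const_nhds.div hZ (N.Z_pos le_rfl).ne'
  · exact (hε.mul_const _).div hZ (N.Z_pos le_rfl).ne'

lemma stat_zero_of_notMem {x : V} (hx : x ∉ N.term) : N.stat 0 x = 0 := by
  simp [stat, hx]

lemma energy_eq (F : V → ℝ) (ε : Set.Ioi (0 : ℝ)) (ρ : V → ℝ) :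
    (N.system F ε).energy ρ = ∑ x, ((ρ x / N.stat ε x * Real.log (ρ x / N.stat ε x)
      - ρ x / N.stat ε x + 1) * N.stat ε x + ρ x * F x) :=
  Finset.sum_add_distrib.symm

/-- The sum may run over all nodes because the terms off the terminals are `0`, through the factor
`π^0_x = 0`. -/
lemma limit_energy_eq (F : V → ℝ) {ρ : V → ℝ} (hρ : ∀ x, x ∉ N.term → ρ x = 0) :
    (N.limitSystem F).energy (restrictTo N.term ρ) = ∑ x, ((ρ x / N.stat 0 x *
      Real.log (ρ x / N.stat 0 x) - ρ x / N.stat 0 x + 1) * N.stat 0 x + ρ x * F x) := by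
  rw [← N.sum_restrictTo_of_eq_zero fun x hx => by simp [N.stat_zero_of_notMem hx, hρ x hx]]
  exact Finset.sum_add_distrib.symm

lemma energy_term_ge (F : V → ℝ) (ε : Set.Ioi (0 : ℝ)) {ρ : V → ℝ} (hρ : 0 ≤ ρ) (l : ℝ) (x : V) :
    l * ρ x - (Real.exp (l - F x) - 1) * N.stat ε x
      ≤ (ρ x / N.stat ε x * Real.log (ρ x / N.stat ε x) - ρ x / N.stat ε x + 1) * N.stat ε x
        + ρ x * F x := by
  have := entropy_term_ge (N.stat_pos ε.2 x) (hρ x) (l - F x)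
  linarith

/-- Energy bounds force the mass at non-terminal nodes to vanish as `ε ↓ 0`. -/
lemma exists_energy_ge (F : V → ℝ) {ε : ℕ → Set.Ioi (0 : ℝ)}
    (hε : Tendsto (fun n => (ε n : ℝ)) atTop (𝓝 0)) {x : V} (hx : x ∉ N.term) :
    ∃ C : ℝ, ∀ K : ℝ, ∃ c : ℕ → ℝ, Tendsto c atTop (𝓝 C) ∧
      ∀ n (ρ : V → ℝ), 0 ≤ ρ → K * ρ x - c n ≤ (N.system F (ε n)).energy ρ := by
  -- The slope `K` is used only at `x`, where `π^ε_x → 0` absorbs its cost; hence the limit `C` of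
  -- the constants does not depend on `K`.
  refine ⟨∑ y, (Real.exp (0 - F y) - 1) * N.stat 0 y, fun K =>
    ⟨fun n => ∑ y, (Real.exp ((if y = x then K else 0) - F y) - 1) * N.stat (ε n) y, ?_, ?_⟩⟩
  · have h1 := tendsto_finsetSum Finset.univ fun y _ => (N.tendsto_stat hε y).const_mul
      (Real.exp ((if y = x then K else 0) - F y) - 1)
    convert h1 using 2
    refine Finset.sum_congr rfl fun y _ => ?_
    split_ifs with h
    · rw [h, N.stat_zero_of_notMem hx, mul_zero, mul_zero]
    · rfl
  · intro n ρ hρ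
    rw [energy_eq]
    refine le_trans (le_of_eq ?_) (Finset.sum_le_sum fun y _ =>
      N.energy_term_ge F (ε n) hρ (if y = x then K else 0) y)
    rw [Finset.sum_sub_distrib]
    simp

open Classical in
/-- The Γ-limit of the energies. -/
noncomputable def limitEnergy (F ρ : V → ℝ) : EReal :=
  if ∀ x, x ∉ N.term → ρ x = 0 then ((N.limitSystem F).energy (restrictTo N.term ρ) : EReal) else ⊤

lemma gammaConverges_energy (F : V → ℝ) :
    GammaConverges (fun ε => (N.system F ε).energy) (N.limitEnergy F) := by
  intro ε hε ρ hρ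
  refine ⟨fun ρn hρn hlim => ?_, fun _ => ρ, fun _ => hρ, tendsto_const_nhds, ?_⟩
  · have hlim' := tendsto_pi_nhds.mp hlim
    unfold limitEnergy
    split_ifs with h
    · rw [N.limit_energy_eq F h]
      -- Off the terminals the entropy term need not converge, so it is replaced by a lower bound
      -- that tends to `0`.
      set g : ℕ → V → ℝ := fun n x => if x ∈ N.term then
        (ρn n x / N.stat (ε n) x * Real.log (ρn n x / N.stat (ε n) x)
          - ρn n x / N.stat (ε n) x + 1) * N.stat (ε n) x + ρn n x * F x
        else -((Real.exp (0 - F x) - 1) * N.stat (ε n) x) with hg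
      have hgl : Tendsto (fun n => ∑ x, g n x) atTop (𝓝 (∑ x, ((ρ x / N.stat 0 x *
          Real.log (ρ x / N.stat 0 x) - ρ x / N.stat 0 x + 1) * N.stat 0 x + ρ x * F x))) := by
        refine tendsto_finsetSum _ fun x _ => ?_
        by_cases hx : x ∈ N.term
        · simp only [hg, if_pos hx]
          exact (tendsto_entropy_term (N.stat_zero_pos ⟨x, hx⟩) (N.tendsto_stat hε x)
            (hlim' x)).add ((hlim' x).mul_const _)
        · simp only [hg, if_neg hx]
          have h1 := ((N.tendsto_stat hε x).const_mul (Real.exp (0 - F x) - 1)).neg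
          simpa [N.stat_zero_of_notMem hx, h x hx] using h1
      rw [← ((continuous_coe_real_ereal.tendsto _).comp hgl).liminf_eq]
      refine liminf_le_liminf (Eventually.of_forall fun n => ?_)
      refine EReal.coe_le_coe_iff.mpr ?_
      beta_reduce
      rw [energy_eq]
      refine Finset.sum_le_sum fun x _ => ?_
      simp only [hg]
      split_ifs
      · exact le_rfl
      · have := N.energy_term_ge F (ε n) (hρn n) 0 x
        linarith
    · push Not at h
      obtain ⟨x, hx, hρx⟩ := h
      have hpos : 0 < ρ x := lt_of_le_of_ne (hρ x) (Ne.symm hρx)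
      obtain ⟨C, hC⟩ := N.exists_energy_ge F hε hx
      rw [top_le_iff, EReal.eq_top_iff_forall_lt]
      intro y
      -- This slope makes the lower bounds converge to `y + 1`, with `y` arbitrary.
      obtain ⟨c, hc, hcE⟩ := hC ((y + C + 1) / ρ x)
      have h1 : Tendsto (fun n => (y + C + 1) / ρ x * ρn n x - c n) atTop (𝓝 (y + 1)) := by
        have := ((hlim' x).const_mul ((y + C + 1) / ρ x)).sub hc
        rw [div_mul_cancel₀ _ hpos.ne'] at this
        convert this using 2
        ring
      have h2 : ((y + 1 : ℝ) : EReal) ≤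
          liminf (fun n => ((N.system F (ε n)).energy (ρn n) : EReal)) atTop := by
        rw [← ((continuous_coe_real_ereal.tendsto _).comp h1).liminf_eq]
        exact liminf_le_liminf (Eventually.of_forall fun n =>
          EReal.coe_le_coe_iff.mpr (hcE n _ (hρn n)))
      exact lt_of_lt_of_le (EReal.coe_lt_coe_iff.mpr (lt_add_one y)) h2
  · unfold limitEnergy
    split_ifs with h
    · rw [N.limit_energy_eq F h]
      refine le_of_eq (Tendsto.limsup_eq ((continuous_coe_real_ereal.tendsto _).comp ?_))
      simp_rw [energy_eq]
      refine tendsto_finsetSum _ fun x _ => Tendsto.add_const _ ?_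
      by_cases hx : x ∈ N.term
      · exact tendsto_entropy_term (N.stat_zero_pos ⟨x, hx⟩) (N.tendsto_stat hε x)
          tendsto_const_nhds
      · simpa [h x hx] using N.tendsto_stat hε x
    · exact le_top

/-- Limits of curves with bounded energies do not charge the non-terminal nodes. -/
lemma eq_zero_of_energy_le (F : V → ℝ) {T : ℝ} (hT : 0 < T) {ε : ℕ → Set.Ioi (0 : ℝ)}
    (hε : Tendsto (fun n => (ε n : ℝ)) atTop (𝓝 0)) {ρn : ℕ → ℝ → V → ℝ}
    {jn : ℕ → ℝ → N.Edge → ℝ} {ρ : ℝ → V → ℝ} {j : ℝ → N.Edge → ℝ}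
    (hn : ∀ n, N.graph.CE T (ρn n) (jn n)) (h : N.graph.CE T ρ j)
    (hconv : ConvergesInCE T ρn jn ρ j) {M : ℝ}
    (hM : ∀ n, ∀ t ∈ Set.Icc 0 T, (N.system F (ε n)).energy (ρn n t) ≤ M) :
    ∀ t ∈ Set.Icc 0 T, ∀ x, x ∉ N.term → ρ t x = 0 := by
  intro t ht x hx
  obtain ⟨C, hC⟩ := N.exists_energy_ge F hε hx
  -- The right side is independent of `K`, so the integral vanishes. Weak convergence only controls
  -- time integrals; continuity of `ρ` gives every `t`.
  have hbound : ∀ K : ℝ, K * ∫ t in Set.Icc 0 T, ρ t x ≤ T * (M + C) := by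
    intro K
    obtain ⟨c, hc, hcE⟩ := hC K
    have h1 := (hconv.rho x (fun _ => K) continuous_const)
    rw [integral_const_mul] at h1
    refine le_of_tendsto_of_tendsto' h1 ((hc.const_add M).const_mul T) fun n => ?_
    have h2 : ∫ t in Set.Icc 0 T, K * ρn n t x ≤ ∫ _ in Set.Icc 0 T, (M + c n) := by
      refine setIntegral_mono_on (((hn n).integrableOn_rho x).const_mul K)
        (integrable_const _) measurableSet_Icc fun t ht => ?_
      have := hcE n _ ((hn n).nonneg t ht)
      linarith [hM n t ht]
    refine h2.trans (le_of_eq ?_)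
    simp [hT.le]
  have hnn : ∀ᵐ t ∂volume.restrict (Set.Icc 0 T), 0 ≤ ρ t x := by
    filter_upwards [ae_restrict_mem measurableSet_Icc] with t ht
    exact h.nonneg t ht x
  have h0 : ∫ t in Set.Icc 0 T, ρ t x = 0 := by
    refine le_antisymm ?_ (integral_nonneg_of_ae hnn)
    by_contra! hpos
    have := hbound ((T * (M + C) + 1) / ∫ t in Set.Icc 0 T, ρ t x)
    rw [div_mul_cancel₀ _ hpos.ne'] at this
    linarith
  have hae := (setIntegral_eq_zero_iff_of_nonneg_ae hnn (h.integrableOn_rho x)).mp h0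
  exact Measure.eqOn_Icc_of_ae_eq volume hT.ne hae
    ((continuous_apply x).comp_continuousOn h.continuousOn) continuousOn_const ht

/-! ### Contraction of the flux -/

/-- The flux through the single edge of the limit graph: the net flux out of `a`. -/
noncomputable def contractFlux (j : ℝ → N.Edge → ℝ) (t : ℝ) (_ : Unit) : ℝ :=
  ∑ e, N.graph.grad (fun x => if x = N.a then 0 else 1) e * j t e

lemma contractFlux_CE {T : ℝ} {ρ : ℝ → V → ℝ} {j : ℝ → N.Edge → ℝ} (h : N.graph.CE T ρ j)
    (hρ : ∀ t ∈ Set.Icc 0 T, ∀ x, x ∉ N.term → ρ t x = 0) :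
    N.limitGraph.CE T (fun t => restrictTo N.term (ρ t)) (N.contractFlux j) where
  nonneg t ht x := h.nonneg t ht x
  continuousOn := continuousOn_pi.mpr fun x =>
    (continuous_apply (x : V)).comp_continuousOn h.continuousOn
  integrableOn _ := integrable_finsetSum _ fun e _ => (h.integrableOn e).const_mul _
  weak φ hφ := by
    -- Any extension to interior nodes is allowed, since no mass sits there. This one has gradient
    -- `(φ_b - φ_a)` times that of the indicator of `x ≠ a`, which matches `contractFlux`.
    set ψ : V → ℝ → ℝ := fun x => if x = N.a then φ N.termA else φ N.termB with hψ
    have hψφ : ∀ x : N.term, φ x = ψ x := by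
      rintro ⟨x, hx⟩
      rcases Finset.mem_insert.mp hx with rfl | hx'
      · simp [hψ, termA]
      · rw [Finset.mem_singleton] at hx'
        subst hx'
        simp [hψ, termB, N.a_ne_b.symm]
    have hw := h.weak ψ fun x => by
      simp only [hψ]
      split_ifs
      · exact hφ N.termA
      · exact hφ N.termB
    refine Eq.trans ?_ hw
    congr 1
    · refine setIntegral_congr_fun measurableSet_Icc fun t ht => ?_
      simp only [hψφ]
      exact N.sum_restrictTo_of_eq_zero (f := fun x => deriv (ψ x) t * ρ t x)
        fun x hx => by rw [hρ t ht x hx, mul_zero]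
    · congr 1
      funext t
      simp only [Finset.univ_unique, Finset.sum_singleton, contractFlux, Finset.mul_sum]
      refine Finset.sum_congr rfl fun e _ => ?_
      simp only [hψ, EdgeGraph.grad, limitGraph]
      split_ifs <;> ring

/-- Along curves that do not charge the non-terminal nodes, the flux `j` and the contracted flux
agree when tested with gradients. -/
lemma integral_grad_mul_eq {T : ℝ} {ρ : ℝ → V → ℝ} {j : ℝ → N.Edge → ℝ} (h : N.graph.CE T ρ j)
    (hρ : ∀ t ∈ Set.Icc 0 T, ∀ x, x ∉ N.term → ρ t x = 0) {φ : V → ℝ → ℝ}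
    (hφ : ∀ x, ContDiff ℝ 1 (φ x) ∧ HasCompactSupport (φ x) ∧ tsupport (φ x) ⊆ Set.Ioo 0 T) :
    ∫ t in Set.Icc 0 T, ∑ e, N.graph.grad (fun x => φ x t) e * j t e
      = ∫ t in Set.Icc 0 T, (φ N.b t - φ N.a t) * N.contractFlux j t () := by
  have h1 := h.weak φ hφ
  have h2 := (N.contractFlux_CE h hρ).weak (fun x => φ x) fun x => hφ x
  have h3 : ∫ t in Set.Icc 0 T, ∑ x : N.term, deriv (φ x) t * restrictTo N.term (ρ t) x
      = ∫ t in Set.Icc 0 T, ∑ x, deriv (φ x) t * ρ t x := by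
    refine setIntegral_congr_fun measurableSet_Icc fun t ht => ?_
    exact N.sum_restrictTo_of_eq_zero (f := fun x => deriv (φ x) t * ρ t x)
        fun x hx => by rw [hρ t ht x hx, mul_zero]
  rw [h3] at h2
  simp only [Finset.univ_unique, Finset.sum_singleton, EdgeGraph.grad, limitGraph, termA, termB]
    at h2
  simp only [EdgeGraph.grad] at h1 ⊢
  -- Both continuity equations contain the same density term, so their flux terms agree.
  exact add_left_cancel (h1.trans h2.symm)

/-- The coefficients of the densities at `a` and `b` in the affine minorants are continuous. -/
lemma exists_twoPointMinorant_eq (F : V → ℝ) {ξ l : ℝ → ℝ} (hξ : Continuous ξ)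
    (hl : Continuous l) (c : ℝ) : ∃ A B : ℝ → ℝ, Continuous A ∧ Continuous B ∧
      ∀ t (ρ : V → ℝ), twoPointMinorant c 0 (tiltDensity (N.stat 0) F ρ N.a)
        (tiltDensity (N.stat 0) F ρ N.b) (ξ t) (l t) = A t * ρ N.a + B t * ρ N.b := by
  refine ⟨fun t => c * (2 - 2 * Real.cosh (ξ t / 2) * Real.exp (l t)) *
      (Real.exp (F N.a) / N.stat 0 N.a),
    fun t => c * (2 - 2 * Real.cosh (ξ t / 2) * Real.exp (-l t)) *
      (Real.exp (F N.b) / N.stat 0 N.b), by fun_prop, by fun_prop, fun t ρ => ?_⟩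
  unfold twoPointMinorant tiltDensity
  ring

/-! ### Passage to the limit in the dissipation -/

/-- The liminf inequality for the dissipation functionals. -/
lemma dissipation_liminf (F : V → ℝ) {T τ : ℝ} (hτ : τ ∈ Set.Ioc 0 T) {ε : ℕ → Set.Ioi (0 : ℝ)}
    {ρn : ℕ → ℝ → V → ℝ} {jn : ℕ → ℝ → N.Edge → ℝ} {ρ : ℝ → V → ℝ} {j : ℝ → N.Edge → ℝ}
    (hn : ∀ n, N.graph.CE T (ρn n) (jn n)) (hce : N.graph.CE T ρ j)
    (hconv : ConvergesInCE T ρn jn ρ j)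
    (hρ : ∀ t ∈ Set.Icc 0 T, ∀ x, x ∉ N.term → ρ t x = 0) :
    (N.limitSystem F).dissipation τ (fun t => restrictTo N.term (ρ t)) (N.contractFlux j)
      ≤ liminf (fun n => (N.system F (ε n)).dissipation τ (ρn n) (jn n)) atTop := by
  obtain ⟨h, ha, hb, h01, hh, hz⟩ := N.exists_equilibrium_potential F
  have hlim := N.contractFlux_CE hce hρ
  have hlimτ := hlim.mono hτ.2
  have hceτ := hce.mono hτ.2
  have hdens : ∀ x, IntegrableOn (fun t => tiltDensity (N.stat 0) F (ρ t) x) (Set.Icc 0 τ) :=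
    fun x => ((hceτ.integrableOn_rho x).div_const _).mul_const _
  have hdens0 : ∀ x ∈ N.term, ∀ t ∈ Set.Icc 0 τ, 0 ≤ tiltDensity (N.stat 0) F (ρ t) x :=
    fun x hx t ht => mul_nonneg (div_nonneg (hceτ.nonneg t ht x)
      (N.stat_zero_pos ⟨x, hx⟩).le) (Real.exp_pos _).le
  rw [GradSystem.dissipation, if_pos hlimτ]
  refine lintegral_twoPoint_dissipation_le (N.capacity_nonneg F) (hlimτ.integrableOn ())
    (hdens N.a) (hdens N.b) (hdens0 N.a (by simp [term])) (hdens0 N.b (by simp [term])) ?_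
  intro ξ l hξ hl
  set c := N.capacity F with hc
  set Φ := testPotential h ξ l with hΦ
  have hΦτ := testPotential_spec h01 hξ hl
  have hΦT : ∀ x, ContDiff ℝ 1 (Φ x) ∧ HasCompactSupport (Φ x) ∧ tsupport (Φ x) ⊆ Set.Ioo 0 T :=
    fun x => ⟨(hΦτ x).1, (hΦτ x).2.1, (hΦτ x).2.2.trans (Set.Ioo_subset_Ioo_right hτ.2)⟩
  have hgradc : ∀ e, Continuous fun t => N.graph.grad (fun x => Φ x t) e := fun e =>
    ((hΦτ _).1.continuous).sub ((hΦτ _).1.continuous)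
  obtain ⟨A, B, hA, hB, hAB⟩ := N.exists_twoPointMinorant_eq F hξ.1.continuous hl.1.continuous c
  have hξ0 : ∀ t, t ∉ Set.Ioo 0 τ → ξ t = 0 := fun t ht =>
    image_eq_zero_of_notMem_tsupport fun h => ht (hξ.2.2 h)
  have hl0 : ∀ t, t ∉ Set.Ioo 0 τ → l t = 0 := fun t ht =>
    image_eq_zero_of_notMem_tsupport fun h => ht (hl.2.2 h)
  -- A weakly continuous linear functional on `[0,T]`. Its integrand vanishes outside `(0,τ)`, so it
  -- measures dissipation up to time `τ` while convergence is known on `[0,T]`.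
  set I : (ℝ → V → ℝ) → (ℝ → N.Edge → ℝ) → ℝ := fun ρ j => ∫ t in Set.Icc 0 T,
    ((∑ e, N.graph.grad (fun x => Φ x t) e * j t e) + (A t * ρ t N.a + B t * ρ t N.b)) with hI
  have hint1 : ∀ {ρ : ℝ → V → ℝ} {j : ℝ → N.Edge → ℝ}, N.graph.CE T ρ j → ∀ e,
      IntegrableOn (fun t => N.graph.grad (fun x => Φ x t) e * j t e) (Set.Icc 0 T) :=
    fun hce e => integrableOn_continuous_mul (hgradc e) (hce.integrableOn e)
  have hint2 : ∀ {ρ : ℝ → V → ℝ} {j : ℝ → N.Edge → ℝ}, N.graph.CE T ρ j →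
      IntegrableOn (fun t => A t * ρ t N.a) (Set.Icc 0 T) ∧
      IntegrableOn (fun t => B t * ρ t N.b) (Set.Icc 0 T) := fun hce =>
    ⟨integrableOn_continuous_mul hA (hce.integrableOn_rho _),
      integrableOn_continuous_mul hB (hce.integrableOn_rho _)⟩
  have hint3 : ∀ {ρ : ℝ → V → ℝ} {j : ℝ → N.Edge → ℝ}, N.graph.CE T ρ j →
      IntegrableOn (fun t => A t * ρ t N.a + B t * ρ t N.b) (Set.Icc 0 T) := fun hce =>
    (hint2 hce).1.add (hint2 hce).2
  have hIeq : ∀ {ρ : ℝ → V → ℝ} {j : ℝ → N.Edge → ℝ}, N.graph.CE T ρ j →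
      I ρ j = (∑ e, ∫ t in Set.Icc 0 T, N.graph.grad (fun x => Φ x t) e * j t e)
        + ((∫ t in Set.Icc 0 T, A t * ρ t N.a) + ∫ t in Set.Icc 0 T, B t * ρ t N.b) := by
    intro ρ j hce
    rw [hI]
    dsimp only
    rw [integral_add (integrable_finsetSum _ fun e _ => hint1 hce e)
      (hint3 hce), integral_add (hint2 hce).1 (hint2 hce).2,
      integral_finsetSum _ fun e _ => hint1 hce e]
  have hItend : Tendsto (fun n => I (ρn n) (jn n)) atTop (𝓝 (I ρ j)) := by
    rw [hIeq hce]
    simp_rw [fun n => hIeq (hn n)]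
    exact (tendsto_finsetSum _ fun e _ => hconv.flux e _ (hgradc e)).add
      ((hconv.rho _ _ hA).add (hconv.rho _ _ hB))
  have hIlim : ∫ t in Set.Icc 0 τ, twoPointMinorant c (N.contractFlux j t ())
      (tiltDensity (N.stat 0) F (ρ t) N.a) (tiltDensity (N.stat 0) F (ρ t) N.b) (ξ t) (l t)
      = I ρ j := by
    rw [← setIntegral_Icc_of_eq_zero hτ.2 fun t ht => by
      rw [hξ0 t ht, hl0 t ht, twoPointMinorant_zero], hI]
    dsimp only
    rw [integral_add (integrable_finsetSum _ fun e _ => hint1 hce e)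
      (hint3 hce), N.integral_grad_mul_eq hce hρ hΦT]
    simp_rw [hΦ, testPotential_terminals N ha hb]
    rw [← integral_add
      (integrableOn_continuous_mul hξ.1.continuous (hlim.integrableOn ())) (hint3 hce)]
    congr 1
    funext t
    rw [← hAB]
    unfold twoPointMinorant
    ring
  have hIn : ∀ n, ENNReal.ofReal (I (ρn n) (jn n))
      ≤ (N.system F (ε n)).dissipation τ (ρn n) (jn n) := by
    intro n
    rw [GradSystem.dissipation, if_pos ((hn n).mono hτ.2), hI]
    dsimp only
    rw [setIntegral_Icc_of_eq_zero hτ.2]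
    · refine (ofReal_integral_le_lintegral_ofReal _ _).trans
        (setLIntegral_mono' measurableSet_Icc fun t ht => ?_)
      rw [← hAB]
      exact N.system_dissipation_rate_ge ha hb h01 hh hz (ε n)
        (((hn n).mono hτ.2).nonneg t ht) (jn n t) (ξ t) (l t)
    · intro t ht
      rw [← hAB, hξ0 t ht, hl0 t ht, twoPointMinorant_zero, add_zero]
      refine Finset.sum_eq_zero fun e _ => ?_
      have h0 : ∀ x, Φ x t = 0 := fun x =>
        image_eq_zero_of_notMem_tsupport fun h => ht ((hΦτ x).2.2 h)
      simp [EdgeGraph.grad, h0]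
  change ENNReal.ofReal (∫ t in Set.Icc 0 τ, twoPointMinorant c (N.contractFlux j t ())
    (tiltDensity (N.stat 0) F (ρ t) N.a) (tiltDensity (N.stat 0) F (ρ t) N.b) (ξ t) (l t)) ≤ _
  rw [hIlim, ← (ENNReal.tendsto_ofReal hItend).liminf_eq]
  exact liminf_le_liminf (Eventually.of_forall hIn)

end TwoTerminalNetwork

theorem mainTheorem4 {V : Type*} [Fintype V] [DecidableEq V] (N : TwoTerminalNetwork V) :
    TiltEDPConverges N.system N.limitSystem := by
  classical
  refine fun F => ⟨N.limitEnergy F, N.gammaConverges_energy F, fun ρ _ => by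
    unfold TwoTerminalNetwork.limitEnergy; congr, fun T hT =>
    -- The value `⊤` is never met: bounded energies along the sequence, or finite limit energy, each
    -- confine `ρ` to the terminals.
    ⟨fun τ ρ j => if ∀ t ∈ Set.Icc 0 T, ∀ x, x ∉ N.term → ρ t x = 0 then
      (N.limitSystem F).dissipation τ (fun t => restrictTo N.term (ρ t)) (N.contractFlux j)
      else ⊤, ?_, ?_⟩⟩
  · rintro ε ρn jn ρ j hε hn hce hconv ⟨M, hM⟩ τ hτ
    have hρ := N.eq_zero_of_energy_le F hT hε hn hce hconv hM
    beta_reduce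
    rw [if_pos hρ]
    exact N.dissipation_liminf F hτ hn hce hconv hρ
  · intro ρ j hce hE
    have hρ : ∀ t ∈ Set.Icc 0 T, ∀ x, x ∉ N.term → ρ t x = 0 := by
      intro t ht
      by_contra hc
      have := hE t ht
      rw [TwoTerminalNetwork.limitEnergy, if_neg hc] at this
      exact lt_irrefl _ this
    exact ⟨N.contractFlux j, N.contractFlux_CE hce hρ, fun τ _ => if_pos hρ⟩
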